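/- There are absolute constants $C_0,C_1,C_2,C_3>0$ such that the following holds for all $n,k$ with $n\ge C_0k^2$. Let $\{(\omega_i,0,\Sigma^{(i)})\}_{i\in[k]}$ be a mixture of $k$ zero-mean Gaussians in $\mathbb R^n$ with $\sum_i\omega_i=1$, $\omega_i\ge\omega_o>0$ and $0\preceq\Sigma^{(i)}\preceq\frac12I_n$, and let $0<\rho<1/n$. Perturb it as follows. Let $\Delta_1,\dots,\Delta_k$ be random symmetric $n\times n$ matrices with zero diagonal whose strictly upper triangular entries are all independent $N(0,\rho^2)$ variables. The matrices $\widetilde\Sigma^{(i)}$ agree with $\Sigma^{(i)}+\Delta_i$ off the diagonal; their diagonals are chosen arbitrarily (possibly depending on all of $\Delta_1,\dots,\Delta_k$), subject to $\widetilde\Sigma^{(i)}\succeq0$ and to the diagonal entries being at most $1$. The perturbation fails if no such diagonals exist; all probabilities below are conditional on its success. Let $\widetilde M_4=\left(\mathbb E[x_{a}x_{b}x_{c}x_{d}]\right)_{a,b,c,d\in[n]}$ be the fourth moment tensor of $x\sim\sum_i\omega_iN(0,\widetilde\Sigma^{(i)})$. Let $\mathcal H\subset[n]$ be any fixed set of size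 $\lfloor\sqrt n\rfloor$, let $S=\mathrm{span}\{\widetilde\Sigma^{(i)}_{[:,j]}:i\in[k],\,j\in\mathcal H\}\subset\mathbb R^n$, and for an $n\times n$ matrix $A$ let $\mathrm{Proj}_{S^\perp}A$ be the matrix obtained by projecting every column of $A$ orthogonally onto $S^\perp$. Let $\widetilde Q_{U_S}$ be the $n^2\times\binom{|\mathcal H|+1}{2}$ matrix with columns $\mathrm{vec}\big(\mathrm{Proj}_{S^\perp}\widetilde M_4(e_{j_1},e_{j_2},I,I)\big)$ for $j_1\le j_2$ in $\mathcal H$, where $\widetilde M_4(e_{j_1},e_{j_2},I,I)$ is the matrix with $(a,b)$ entry $[\widetilde M_4]_{j_1,j_2,a,b}$. Then for every $\epsilon>0$, with probability at least $1-2(C_1\epsilon)^{C_2n}$ over the perturbation, the $k$-th largest singular value satisfies $$\sigma_k(\widetilde Q_{U_S})\ \ge\ C_3\,\omega_o(\epsilon\rho)^2n^{1.5},$$ and the columns of $\widetilde Q_{U_S}$ span exactly $\mathrm{span}\{\mathrm{vec}(\mathrm{Proj}_{S^\perp}\widetilde\Sigma^{(i)}):i\in[k]\}$. -/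

import Mathlib

open MeasureTheory ProbabilityTheory

noncomputable section

/-- A zero-mean Gaussian mixture with `k` components in `ℝⁿ`: nonnegative mixing weights that sum
to one, and positive semidefinite covariance matrices. -/
structure ZeroMeanGMM (n k : ℕ) where
  weight : Fin k → ℝ
  cov : Fin k → Matrix (Fin n) (Fin n) ℝ
  weight_nonneg : ∀ i, 0 ≤ weight i
  weight_sum : ∑ i, weight i = 1
  cov_posSemidef : ∀ i, (cov i).PosSemidef

/-- The scaling `Σ⁽ⁱ⁾ ⪯ (1/2) Iₙ` of the initial instance. -/
def ZeroMeanGMM.IsScaled {n k : ℕ} (G : ZeroMeanGMM n k) : Prop :=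
  ∀ i, ((1 / 2 : ℝ) • (1 : Matrix (Fin n) (Fin n) ℝ) - G.cov i).PosSemidef

/-- `Δ 1, …, Δ k` are random symmetric matrices with zero diagonal whose strictly upper triangular
entries are all independent with law `N(0, ρ²)`. -/
structure IsSymmGaussianNoise {Ω : Type*} [MeasurableSpace Ω] (P : Measure Ω) {n k : ℕ} (ρ : ℝ)
    (Δ : Ω → Fin k → Matrix (Fin n) (Fin n) ℝ) : Prop where
  measurable : ∀ i a b, Measurable fun w => Δ w i a b
  symm : ∀ w i, (Δ w i).IsSymm
  diag_zero : ∀ w i a, Δ w i a a = 0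
  law : ∀ i a b, a < b →
    P.map (fun w => Δ w i a b) = gaussianReal 0 (Real.toNNReal (ρ ^ 2))
  indep : iIndepFun
    (fun (p : Fin k × {q : Fin n × Fin n // q.1 < q.2}) (w : Ω) => Δ w p.1 p.2.1.1 p.2.1.2) P

/-- `C` is an admissible outcome of the perturbation of `G` by the realised noise `D`: off the
diagonal `C i` is `G.cov i + D i`, and the diagonal of `C i` is bounded above by `1` and makes `C i`
positive semidefinite (it is otherwise unrestricted). -/
def IsAdmissible {n k : ℕ} (G : ZeroMeanGMM n k)
    (D C : Fin k → Matrix (Fin n) (Fin n) ℝ) : Prop :=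
  ∀ i, (∀ a b, a ≠ b → C i a b = G.cov i a b + D i a b) ∧ (C i).PosSemidef ∧ ∀ a, C i a a ≤ 1

/-- The perturbation procedure succeeds on the noise `D`: the diagonals can be chosen. -/
def PerturbationSucceeds {n k : ℕ} (G : ZeroMeanGMM n k)
    (D : Fin k → Matrix (Fin n) (Fin n) ℝ) : Prop :=
  ∃ C, IsAdmissible G D C

/-- The law of a sample of the mixture `∑ᵢ wᵢ N(0, Cᵢ)`. -/
def mixtureLaw {n k : ℕ} (w : Fin k → ℝ) (C : Fin k → Matrix (Fin n) (Fin n) ℝ) :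
    Measure (EuclideanSpace ℝ (Fin n)) :=
  ∑ i, ENNReal.ofReal (w i) • multivariateGaussian 0 (C i)

/-- The fourth order moment tensor `E[x_a x_b x_c x_d]` of the mixture. -/
def fourthMoment {n k : ℕ} (w : Fin k → ℝ) (C : Fin k → Matrix (Fin n) (Fin n) ℝ)
    (a b c d : Fin n) : ℝ :=
  ∫ x, x a * x b * x c * x d ∂(mixtureLaw w C)

/-- The two-dimensional slice `M₄(e_{j₁}, e_{j₂}, I, I)`. -/
def momentSlice {n k : ℕ} (w : Fin k → ℝ) (C : Fin k → Matrix (Fin n) (Fin n) ℝ)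
    (j₁ j₂ : Fin n) : Matrix (Fin n) (Fin n) ℝ :=
  Matrix.of fun a b => fourthMoment w C j₁ j₂ a b

/-- The span of the columns `C⁽ⁱ⁾_{[:,j]}` with `i ∈ [k]` and `j ∈ H`. -/
def columnSpan {n k : ℕ} (C : Fin k → Matrix (Fin n) (Fin n) ℝ) (H : Finset (Fin n)) :
    Submodule ℝ (EuclideanSpace ℝ (Fin n)) :=
  Submodule.span ℝ {v | ∃ i, ∃ j ∈ H, v = WithLp.toLp 2 ((C i).col j)}

/-- `Proj_{S^⊥} A`: every column of `A` is projected orthogonally onto `S^⊥`. -/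
def projPerp {n : ℕ} (S : Submodule ℝ (EuclideanSpace ℝ (Fin n)))
    (A : Matrix (Fin n) (Fin n) ℝ) : Matrix (Fin n) (Fin n) ℝ :=
  Matrix.of fun a b => Sᗮ.starProjection (WithLp.toLp 2 (A.col b)) a

/-- The matrix `Q_{U_S}`, whose columns are the vectors `vec(Proj_{S^⊥} M₄(e_{j₁}, e_{j₂}, I, I))`
for `j₁ ≤ j₂` in `H`, where `S` is the span of the columns of the covariances indexed by `H`. -/
def matrixQUS {n k : ℕ} (w : Fin k → ℝ) (C : Fin k → Matrix (Fin n) (Fin n) ℝ)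
    (H : Finset (Fin n)) :
    Matrix (Fin n × Fin n) {p : Fin n × Fin n // p.1 ≤ p.2 ∧ p.1 ∈ H ∧ p.2 ∈ H} ℝ :=
  Matrix.of fun r p =>
    Matrix.vec (projPerp (columnSpan C H) (momentSlice w C p.1.1 p.1.2)) r

/-- The `r`-th largest singular value of a real matrix, counted from `r = 1`. -/
def kthSingularValue {ι κ : Type*} [Fintype ι] [Fintype κ] [DecidableEq κ]
    (A : Matrix ι κ ℝ) (r : ℕ) : ℝ :=
  (Matrix.toEuclideanLin A).singularValues (r - 1)

end

/-!
By Isserlis' theorem the slice `M₄(e_{j₁}, e_{j₂}, I, I)` of the fourth moment is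
`∑ᵢ ωᵢ (Cᵢ[j₁, j₂] Cᵢ + Cᵢ[:, j₁] Cᵢ[:, j₂]ᵀ + Cᵢ[:, j₂] Cᵢ[:, j₁]ᵀ)`, where `Cᵢ` are the perturbed
covariances. For `j₁, j₂ ∈ H` the rank-one terms vanish under the projection to `S^⊥`, which gives
the factorization `Q_{U_S} = A diag(ω) Bᵀ` (`matrixQUS_eq`): the columns of `A` are
`vec (Proj_{S^⊥} Cᵢ)` and `B` collects the entries `Cᵢ[j₁, j₂]`. Hence
`σ_k(Q_{U_S}) ≥ σ_k(A) ω₀ σ_k(B)`, and as soon as this is positive the column spans of `Q_{U_S}` and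
`A` agree, because both have dimension at most `k`. It remains to bound `A` and `B` from below by
`ερn` and `ερ√n` up to constants, with failure probability `(Cε)^{cn}`.

Both bounds come from `stdGaussian_shifted_near_le`: for `k` Gaussian vectors in dimension `N` with
arbitrary means and `k² ≤ N`, and a fixed subspace `W` of dimension at most about `N / 2`, every
unit combination has distance at least `ερ√N` from `W`. The means are absorbed into `W`, so no bound
on them enters. For a single combination, rotation invariance of the Gaussian measure and a Chernoff
bound give the small-ball probability `(Cε)^{N - dim W}` (`blockComb_smallBall`). The union over unit
vectors uses a grid in `ℝᵏ`; its cardinality `(Ck/ε²)ᵏ` is harmless since `kᵏ ≤ 2^{k²}` and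
`k² ≤ N`.

For `B` only the independent entries above the diagonal of `H × H` are used, about `n / 2` of them,
and `W = 0`. For `A`, the subspace `S` depends on the noise and on the arbitrary diagonals. Take
disjoint sets `I`, `J` of `⌊n/4⌋` indices outside `H`. Restricting to rows in `I` and columns in `J`
can only decrease the distance from `S`, and on these rows `S` is spanned by the columns
`Cᵢ[I, j]`, `j ∈ H`, which do not involve the diagonals and are independent of the block `I × J`
(`stdGaussian_prod_columnComb_near_le`, `IsSymmGaussianNoise.block_near_le`). The exceptional set is
open, hence measurable, and Fubini's theorem applies.

Conditioning costs a factor `2`: `Σᵢ + Δᵢ + I/2` is admissible unless `Δᵢ` has an eigenvalue below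
`-1/2`, and as `ρ < 1/n` a grid in `ℝⁿ` and Gaussian tails show that this has probability at most
`1/2` (`IsSymmGaussianNoise.half_le_succeeds`).
-/

/-! ### Standard Gaussian vectors -/

/-- A linear map whose dual preserves norms (for instance an orthogonal projection onto a subspace)
pushes the standard Gaussian measure forward to the standard Gaussian measure. -/
lemma stdGaussian_map_of_norm_comp {E F : Type*} [NormedAddCommGroup E] [InnerProductSpace ℝ E]
    [FiniteDimensional ℝ E] [MeasurableSpace E] [BorelSpace E] [NormedAddCommGroup F]
    [InnerProductSpace ℝ F] [FiniteDimensional ℝ F] [MeasurableSpace F] [BorelSpace F]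
    (f : E →L[ℝ] F) (hf : ∀ L : StrongDual ℝ F, ‖L.comp f‖ = ‖L‖) :
    (stdGaussian E).map f = stdGaussian F := by
  apply Measure.ext_of_charFunDual
  ext L
  rw [charFunDual_map, charFunDual_stdGaussian, charFunDual_stdGaussian, hf]

lemma gaussianPDFReal_smul_exp_sq (c x : ℝ) :
    gaussianPDFReal 0 1 x • Real.exp (c * x ^ 2)
      = (√(2 * Real.pi))⁻¹ * Real.exp (-(1 / 2 - c) * x ^ 2) := by
  simp only [gaussianPDFReal, NNReal.coe_one, mul_one, sub_zero, smul_eq_mul]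
  rw [mul_assoc, ← Real.exp_add]
  ring_nf

lemma integrable_exp_sq_gaussianReal {c : ℝ} (hc : c < 1 / 2) :
    Integrable (fun x : ℝ => Real.exp (c * x ^ 2)) (gaussianReal 0 1) := by
  rw [gaussianReal_of_var_ne_zero _ one_ne_zero]
  have h : Integrable (fun x : ℝ => (gaussianPDF 0 1 x).toReal • Real.exp (c * x ^ 2)) := by
    simp only [toReal_gaussianPDF, gaussianPDFReal_smul_exp_sq]
    exact (integrable_exp_neg_mul_sq (by linarith)).const_mul _
  rwa [integrable_withDensity_iff_integrable_smul' (measurable_gaussianPDF 0 1)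
    (by filter_upwards with x; exact gaussianPDF_lt_top)]

lemma integral_exp_sq_gaussianReal {c : ℝ} (hc : c < 1 / 2) :
    ∫ x, Real.exp (c * x ^ 2) ∂(gaussianReal 0 1) = (√(1 - 2 * c))⁻¹ := by
  rw [integral_gaussianReal_eq_integral_smul one_ne_zero]
  simp only [gaussianPDFReal_smul_exp_sq]
  rw [integral_const_mul, integral_gaussian]
  have h1 : (0 : ℝ) < 1 - 2 * c := by linarith
  rw [show Real.pi / (1 / 2 - c) = (2 * Real.pi) / (1 - 2 * c) by field_simp,
    Real.sqrt_div (by positivity)]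
  have : √(2 * Real.pi) ≠ 0 := by positivity
  field_simp

section
variable {E : Type*} [NormedAddCommGroup E] [InnerProductSpace ℝ E]
    [FiniteDimensional ℝ E]

lemma exp_mul_norm_sq_sum_basis (c : ℝ) (x : Fin (Module.finrank ℝ E) → ℝ) :
    Real.exp (c * ‖∑ i, x i • stdOrthonormalBasis ℝ E i‖ ^ 2)
      = ∏ i, Real.exp (c * x i ^ 2) := by
  rw [← Real.exp_sum, ← Finset.mul_sum]
  congr 2
  have := (stdOrthonormalBasis ℝ E).sum_sq_norm_inner_right
    (∑ i, x i • stdOrthonormalBasis ℝ E i)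
  rw [← this]
  refine Finset.sum_congr rfl fun i _ => ?_
  rw [(stdOrthonormalBasis ℝ E).orthonormal.inner_right_fintype]
  simp

variable [MeasurableSpace E] [BorelSpace E]

lemma integrable_exp_normSq_stdGaussian {c : ℝ} (hc : c < 1 / 2) :
    Integrable (fun x : E => Real.exp (c * ‖x‖ ^ 2)) (stdGaussian E) := by
  rw [stdGaussian, integrable_map_measure (by fun_prop)
    (Measurable.aemeasurable (by fun_prop))]
  simp only [Function.comp_def, exp_mul_norm_sq_sum_basis]
  exact Integrable.fintype_prod (f := fun _ x => Real.exp (c * x ^ 2))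
    fun _ => integrable_exp_sq_gaussianReal hc

/-- The exponential moments of the squared norm of a standard Gaussian vector. -/
lemma integral_exp_normSq_stdGaussian {c : ℝ} (hc : c < 1 / 2) :
    ∫ x : E, Real.exp (c * ‖x‖ ^ 2) ∂(stdGaussian E)
      = ((√(1 - 2 * c))⁻¹) ^ Module.finrank ℝ E := by
  rw [stdGaussian, integral_map (Measurable.aemeasurable (by fun_prop)) (by fun_prop)]
  simp only [exp_mul_norm_sq_sum_basis]
  rw [integral_fintype_prod_eq_pow (f := fun x => Real.exp (c * x ^ 2)),
    integral_exp_sq_gaussianReal hc, Fintype.card_fin]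

/-- A standard Gaussian vector in dimension `m` is unlikely to have norm much smaller
than `√m`. -/
lemma stdGaussian_smallBall {s : ℝ} (hs : 0 < s) :
    (stdGaussian E).real {x | ‖x‖ ^ 2 ≤ s ^ 2 * Module.finrank ℝ E}
      ≤ (2 * s) ^ Module.finrank ℝ E := by
  set m := Module.finrank ℝ E
  -- the exponent `-1/(2s²)` balances the two factors of the Chernoff bound
  set c : ℝ := -(1 / (2 * s ^ 2)) with hc
  have hc0 : c < 0 := by rw [hc]; simp; positivity
  have h := mul_meas_ge_le_integral_of_nonneg (μ := stdGaussian E)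
    (f := fun x : E => Real.exp (c * ‖x‖ ^ 2))
    (Filter.Eventually.of_forall fun x => (Real.exp_pos _).le)
    (integrable_exp_normSq_stdGaussian (by linarith)) (Real.exp (-(m / 2)))
  rw [integral_exp_normSq_stdGaussian (by linarith)] at h
  have hset : {x : E | ‖x‖ ^ 2 ≤ s ^ 2 * m} ⊆ {x | Real.exp (-(m / 2)) ≤
      Real.exp (c * ‖x‖ ^ 2)} := by
    intro x hx
    simp only [Set.mem_ofPred_eq, Real.exp_le_exp] at hx ⊢
    have := mul_le_mul_of_nonpos_left hx hc0.le
    refine le_trans (le_of_eq ?_) this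
    rw [hc]; field_simp
  have h2 := (mul_le_mul_of_nonneg_left (measureReal_mono hset)
    (Real.exp_pos (-(m / 2 : ℝ))).le).trans h
  have h3 : (√(1 - 2 * c))⁻¹ ≤ s := by
    rw [inv_le_comm₀ (Real.sqrt_pos.2 (by linarith)) hs]
    apply Real.le_sqrt_of_sq_le
    rw [hc]
    have : s⁻¹ ^ 2 = 2 * (1 / (2 * s ^ 2)) := by field_simp
    linarith
  have h4 : (√(1 - 2 * c))⁻¹ ^ m ≤ s ^ m := pow_le_pow_left₀ (by positivity) h3 m
  have h5 : Real.exp (m / 2) ≤ 2 ^ m := by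
    rw [show (m / 2 : ℝ) = m * (1 / 2) by ring, Real.exp_nat_mul]
    refine pow_le_pow_left₀ (Real.exp_pos _).le ?_ m
    have h := Real.exp_one_lt_d9
    rw [show (1 : ℝ) = 1 / 2 + 1 / 2 by norm_num, Real.exp_add] at h
    nlinarith [Real.exp_pos (1 / 2 : ℝ)]
  calc (stdGaussian E).real {x | ‖x‖ ^ 2 ≤ s ^ 2 * m}
      = Real.exp (m / 2) * (Real.exp (-(m / 2)) *
          (stdGaussian E).real {x | ‖x‖ ^ 2 ≤ s ^ 2 * m}) := by
        rw [← mul_assoc, ← Real.exp_add]; simp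
    _ ≤ 2 ^ m * s ^ m := by gcongr; exact h2.trans h4
    _ = _ := by rw [mul_pow]

/-- A standard Gaussian vector in dimension `m` is unlikely to have norm much larger
than `√m`. -/
lemma stdGaussian_norm_tail {ε : ℝ} (hε : 0 < ε) :
    (stdGaussian E).real {x | (Module.finrank ℝ E : ℝ) / ε ^ 2 ≤ ‖x‖ ^ 2}
      ≤ (6 * ε ^ 2) ^ Module.finrank ℝ E := by
  set m := Module.finrank ℝ E
  have h := mul_meas_ge_le_integral_of_nonneg (μ := stdGaussian E)
    (f := fun x : E => Real.exp ((1 / 4) * ‖x‖ ^ 2))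
    (Filter.Eventually.of_forall fun x => (Real.exp_pos _).le)
    (integrable_exp_normSq_stdGaussian (by norm_num)) (Real.exp ((1 / 4) * (m / ε ^ 2)))
  rw [integral_exp_normSq_stdGaussian (by norm_num)] at h
  have hset : {x : E | (m : ℝ) / ε ^ 2 ≤ ‖x‖ ^ 2} ⊆ {x | Real.exp ((1 / 4) * (m / ε ^ 2)) ≤
      Real.exp ((1 / 4) * ‖x‖ ^ 2)} := by
    intro x hx
    simp only [Set.mem_ofPred_eq, Real.exp_le_exp] at hx ⊢
    linarith
  have h2 := (mul_le_mul_of_nonneg_left (measureReal_mono hset)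
    (Real.exp_pos ((1 / 4) * (m / ε ^ 2) : ℝ)).le).trans h
  have h3 : (√(1 - 2 * (1 / 4 : ℝ)))⁻¹ ≤ 3 / 2 := by
    rw [inv_le_comm₀ (Real.sqrt_pos.2 (by norm_num)) (by norm_num)]
    apply Real.le_sqrt_of_sq_le
    norm_num
  have h4 : (√(1 - 2 * (1 / 4 : ℝ)))⁻¹ ^ m ≤ (3 / 2) ^ m :=
    pow_le_pow_left₀ (by positivity) h3 m
  have h5 : Real.exp (-((1 / 4) * (m / ε ^ 2))) ≤ (4 * ε ^ 2) ^ m := by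
    rw [show (-((1 / 4) * (m / ε ^ 2)) : ℝ) = m * (-(1 / (4 * ε ^ 2))) by ring, Real.exp_nat_mul]
    refine pow_le_pow_left₀ (Real.exp_pos _).le ?_ m
    rw [Real.exp_neg, inv_le_comm₀ (Real.exp_pos _) (by positivity)]
    have := Real.add_one_le_exp (1 / (4 * ε ^ 2))
    rw [one_div] at this ⊢
    linarith
  calc (stdGaussian E).real {x | (m : ℝ) / ε ^ 2 ≤ ‖x‖ ^ 2}
      = Real.exp (-((1 / 4) * (m / ε ^ 2))) * (Real.exp ((1 / 4) * (m / ε ^ 2)) *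
          (stdGaussian E).real {x | (m : ℝ) / ε ^ 2 ≤ ‖x‖ ^ 2}) := by
        rw [← mul_assoc, ← Real.exp_add]; simp
    _ ≤ (4 * ε ^ 2) ^ m * (3 / 2) ^ m := by gcongr; exact h2.trans h4
    _ = _ := by rw [← mul_pow]; ring_nf

end

/-! ### Grids and combinations of blocks of a Gaussian vector -/

section
variable {κ ι : Type*} [Fintype κ] [Fintype ι]

/-- The point of the grid `(1/K) ℤ^κ` with index `z`. -/
noncomputable def gridPoint (K : ℕ) (z : κ → ℤ) : EuclideanSpace ℝ κ :=
  WithLp.toLp 2 fun i => (z i : ℝ) / K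

open Classical in
/-- The grid `(1/K) ℤ^κ ∩ [-1, 1]^κ`, given by its indices. -/
noncomputable def gridIndex (κ : Type*) [Fintype κ] (K : ℕ) : Finset (κ → ℤ) :=
  Fintype.piFinset fun _ => Finset.Icc (-(K : ℤ)) K

lemma card_gridIndex (K : ℕ) : (gridIndex κ K).card = (2 * K + 1) ^ Fintype.card κ := by
  classical
  rw [gridIndex, Fintype.card_piFinset, Finset.prod_const, Finset.card_univ, Int.card_Icc]
  congr 1
  omega

lemma exists_gridPoint_near {K : ℕ} (hK : 0 < K) {v : EuclideanSpace ℝ κ} (hv : ‖v‖ ≤ 1) :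
    ∃ z ∈ gridIndex κ K, ‖v - gridPoint K z‖ ≤ √(Fintype.card κ) / K := by
  have hK' : (0 : ℝ) < K := by exact_mod_cast hK
  refine ⟨fun i => ⌊K * v i⌋, ?_, ?_⟩
  · classical
    rw [gridIndex, Fintype.mem_piFinset]
    intro i
    have h1 : |v i| ≤ 1 := by
      have := (PiLp.norm_apply_le v i).trans hv
      rwa [Real.norm_eq_abs] at this
    rw [abs_le] at h1
    rw [Finset.mem_Icc]
    constructor
    · apply Int.le_floor.2
      push_cast
      nlinarith
    · rw [← Int.lt_add_one_iff]
      apply Int.floor_lt.2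
      push_cast
      nlinarith
  · rw [EuclideanSpace.norm_eq]
    have h : ∀ i, ‖(v - gridPoint K fun i => ⌊K * v i⌋) i‖ ^ 2 ≤ (1 / (K : ℝ)) ^ 2 := by
      intro i
      simp only [gridPoint, PiLp.sub_apply, Real.norm_eq_abs, sq_abs]
      have h1 := Int.floor_le (K * v i)
      have h2 := Int.lt_floor_add_one (K * v i)
      have h3 : v i - (⌊K * v i⌋ : ℝ) / K = (K * v i - ⌊K * v i⌋) / K := by field_simp
      rw [h3]
      refine pow_le_pow_left₀ (div_nonneg (by linarith) hK'.le) ?_ 2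
      exact div_le_div_of_nonneg_right (by linarith) hK'.le
    refine (Real.sqrt_le_sqrt (Finset.sum_le_sum fun i _ => h i)).trans ?_
    rw [Finset.sum_const, nsmul_eq_mul, Finset.card_univ, Real.sqrt_mul (by positivity),
      Real.sqrt_sq (by positivity)]
    exact le_of_eq (by ring)

/-- The linear combination `∑ᵢ vᵢ gᵢ` of the blocks `gᵢ = g (i, ·)` of a vector `g`. -/
noncomputable def blockComb (v : EuclideanSpace ℝ κ) :
    EuclideanSpace ℝ (κ × ι) →L[ℝ] EuclideanSpace ℝ ι :=
  LinearMap.toContinuousLinearMap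
    { toFun := fun g => WithLp.toLp 2 fun a => ∑ i, v i * g (i, a)
      map_add' := fun x y => by
        ext a; simp [mul_add, Finset.sum_add_distrib]
      map_smul' := fun c x => by
        ext a; simp only [PiLp.smul_apply, smul_eq_mul, RingHom.id_apply, Finset.mul_sum]
        exact Finset.sum_congr rfl fun i _ => by ring }

@[simp] lemma blockComb_apply (v : EuclideanSpace ℝ κ) (g : EuclideanSpace ℝ (κ × ι)) (a : ι) :
    blockComb v g a = ∑ i, v i * g (i, a) := rfl

lemma blockComb_sub (u v : EuclideanSpace ℝ κ) (g : EuclideanSpace ℝ (κ × ι)) :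
    blockComb (u - v) g = blockComb u g - blockComb v g := by
  ext a; simp [sub_mul, Finset.sum_sub_distrib]

lemma blockComb_smul (c : ℝ) (v : EuclideanSpace ℝ κ) (g : EuclideanSpace ℝ (κ × ι)) :
    blockComb (c • v) g = c • blockComb v g := by
  ext a; simp [Finset.mul_sum, mul_assoc]

lemma norm_blockComb_le (v : EuclideanSpace ℝ κ) (g : EuclideanSpace ℝ (κ × ι)) :
    ‖blockComb v g‖ ≤ ‖v‖ * ‖g‖ := by
  apply le_of_sq_le_sq _ (by positivity)
  rw [mul_pow, EuclideanSpace.real_norm_sq_eq, EuclideanSpace.real_norm_sq_eq,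
    EuclideanSpace.real_norm_sq_eq, Fintype.sum_prod_type, Finset.sum_comm, Finset.mul_sum]
  exact Finset.sum_le_sum fun a _ => Finset.sum_mul_sq_le_sq_mul_sq _ _ _

/-- For a unit vector `v` the map `g ↦ Proj_{W^⊥} (∑ᵢ vᵢ gᵢ)` is a coisometry: its adjoint is
`y ↦ v ⊗ y`. -/
lemma norm_dual_comp_blockComb (W : Submodule ℝ (EuclideanSpace ℝ ι)) {v : EuclideanSpace ℝ κ}
    (hv : ‖v‖ = 1) (L : StrongDual ℝ Wᗮ) :
    ‖L.comp (Wᗮ.orthogonalProjectionOnto.comp (blockComb v))‖ = ‖L‖ := by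
  obtain ⟨y, rfl⟩ := (InnerProductSpace.toDual ℝ Wᗮ).surjective L
  set t : EuclideanSpace ℝ (κ × ι) := WithLp.toLp 2 fun p => v p.1 * (y : EuclideanSpace ℝ ι) p.2
  have h : (InnerProductSpace.toDual ℝ Wᗮ y).comp (Wᗮ.orthogonalProjectionOnto.comp (blockComb v))
      = InnerProductSpace.toDual ℝ _ t := by
    ext g
    simp only [ContinuousLinearMap.comp_apply, InnerProductSpace.toDual_apply_apply]
    rw [Submodule.inner_orthogonalProjectionOnto_eq_of_mem_left, PiLp.inner_apply,
      PiLp.inner_apply, Fintype.sum_prod_type, Finset.sum_comm]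
    refine Finset.sum_congr rfl fun a _ => ?_
    simp only [blockComb_apply, t, RCLike.inner_apply, conj_trivial, Finset.sum_mul]
    exact Finset.sum_congr rfl fun i _ => by ring
  rw [h, LinearIsometryEquiv.norm_map, LinearIsometryEquiv.norm_map]
  have h2 : ‖t‖ ^ 2 = ‖v‖ ^ 2 * ‖(y : EuclideanSpace ℝ ι)‖ ^ 2 := by
    rw [EuclideanSpace.real_norm_sq_eq, EuclideanSpace.real_norm_sq_eq,
      EuclideanSpace.real_norm_sq_eq, Fintype.sum_prod_type, Finset.sum_mul_sum]
    simp [t, mul_pow]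
  rw [hv, one_pow, one_mul] at h2
  simpa using (sq_eq_sq₀ (norm_nonneg _) (norm_nonneg _)).1 h2

/-- Small-ball estimate for the distance of a fixed unit combination of the blocks from `W`. By
rotation invariance the projection to `W^⊥` is a standard Gaussian vector. -/
lemma blockComb_smallBall {W : Submodule ℝ (EuclideanSpace ℝ ι)}
    (hW : 2 * Module.finrank ℝ W ≤ Fintype.card ι) {v : EuclideanSpace ℝ κ} (hv : ‖v‖ = 1)
    {s : ℝ} (hs : 0 < s) :
    (stdGaussian (EuclideanSpace ℝ (κ × ι))).real
      {g | ‖Wᗮ.orthogonalProjectionOnto (blockComb v g)‖ ≤ s * √(Fintype.card ι)}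
      ≤ (3 * s) ^ (Fintype.card ι - Module.finrank ℝ W) := by
  have hm : Module.finrank ℝ Wᗮ = Fintype.card ι - Module.finrank ℝ W := by
    have := W.finrank_add_finrank_orthogonal
    rw [finrank_euclideanSpace] at this
    omega
  set f : EuclideanSpace ℝ (κ × ι) →L[ℝ] Wᗮ := Wᗮ.orthogonalProjectionOnto.comp (blockComb v)
    with hf
  have hfm : Measurable f := f.continuous.measurable
  have hmap : (stdGaussian _).map f = stdGaussian Wᗮ :=
    stdGaussian_map_of_norm_comp f (norm_dual_comp_blockComb W hv)
  have h := stdGaussian_smallBall (E := Wᗮ) (s := 3 / 2 * s) (by positivity)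
  have hms : MeasurableSet {x : Wᗮ | ‖x‖ ^ 2 ≤ (3 / 2 * s) ^ 2 * Module.finrank ℝ Wᗮ} :=
    (isClosed_le (by fun_prop) (by fun_prop)).measurableSet
  rw [← hmap, map_measureReal_apply hfm hms, hm] at h
  refine (measureReal_mono ?_).trans (h.trans (le_of_eq (by ring_nf)))
  intro g hg
  simp only [Set.mem_ofPred_eq, Set.mem_preimage] at hg ⊢
  change ‖Wᗮ.orthogonalProjectionOnto (blockComb v g)‖ ^ 2 ≤ _
  have h1 := pow_le_pow_left₀ (norm_nonneg _) hg 2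
  rw [mul_pow, Real.sq_sqrt (by positivity)] at h1
  have h2 : (Fintype.card ι : ℝ) ≤ 2 * ((Fintype.card ι - Module.finrank ℝ W : ℕ) : ℝ) := by
    have : Fintype.card ι ≤ 2 * (Fintype.card ι - Module.finrank ℝ W) := by omega
    exact_mod_cast this
  nlinarith [mul_le_mul_of_nonneg_left h2 (sq_nonneg s), sq_nonneg s,
    mul_nonneg (sq_nonneg s) (Nat.cast_nonneg (α := ℝ) (Fintype.card ι - Module.finrank ℝ W))]
end

/-! ### Unit combinations of independent Gaussian vectors are far from a fixed subspace -/

section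
variable {κ ι : Type*} [Fintype κ] [Fintype ι]

/-- If some unit combination of the blocks of `g` is close to `W`, and `g` is not too large, then a
combination whose coefficients lie on the grid is close to `W` as well. -/
lemma exists_grid_blockComb_near [Nonempty κ] {W : Submodule ℝ (EuclideanSpace ℝ ι)} {ε : ℝ}
    (hε : 0 < ε) (hε1 : ε ≤ 1) {K : ℕ} (hK : (Fintype.card κ : ℝ) / ε ^ 2 ≤ K)
    (hκ : 4 ≤ K) {g : EuclideanSpace ℝ (κ × ι)}
    (hg : ‖g‖ ^ 2 ≤ (Fintype.card κ * Fintype.card ι : ℝ) / ε ^ 2)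
    {v : EuclideanSpace ℝ κ} (hv : ‖v‖ = 1) {w : EuclideanSpace ℝ ι} (hw : w ∈ W)
    (h : ‖blockComb v g - w‖ ≤ ε * √(Fintype.card ι)) :
    ∃ z ∈ gridIndex κ K, 1 / 2 ≤ ‖(gridPoint K z : EuclideanSpace ℝ κ)‖ ∧
      ‖Wᗮ.orthogonalProjectionOnto (blockComb (gridPoint K z) g)‖
        ≤ 2 * ε * √(Fintype.card ι) := by
  have hk : (1 : ℝ) ≤ Fintype.card κ := by exact_mod_cast Fintype.card_pos
  have hK0 : (4 : ℝ) ≤ K := by exact_mod_cast hκ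
  obtain ⟨z, hz, hvz⟩ := exists_gridPoint_near (K := K) (by omega) hv.le
  have hKk : (Fintype.card κ : ℝ) ≤ K * ε ^ 2 := by
    rwa [div_le_iff₀ (by positivity)] at hK
  refine ⟨z, hz, ?_, ?_⟩
  · have h1 : √(Fintype.card κ) / K ≤ 1 / 2 := by
      rw [div_le_iff₀ (by linarith)]
      apply Real.sqrt_le_iff.2 ⟨by linarith, ?_⟩
      have : (K : ℝ) * ε ^ 2 ≤ K * 1 := by gcongr; exact pow_le_one₀ hε.le hε1
      nlinarith
    have h2 := norm_sub_norm_le v (gridPoint K z)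
    linarith
  · set u : EuclideanSpace ℝ κ := gridPoint K z
    have h1 : Wᗮ.orthogonalProjectionOnto (blockComb u g)
        = Wᗮ.orthogonalProjectionOnto (blockComb v g - w)
          - Wᗮ.orthogonalProjectionOnto (blockComb (v - u) g) := by
      rw [blockComb_sub, ← map_sub]
      have : Wᗮ.orthogonalProjectionOnto w = 0 :=
        Submodule.orthogonalProjectionOnto_eq_zero_iff.2 (W.le_orthogonal_orthogonal hw)
      rw [show blockComb v g - w - (blockComb v g - blockComb u g) = blockComb u g - w by abel,
        map_sub, this, sub_zero]
    have h2 := Wᗮ.norm_orthogonalProjectionOnto_apply_le (blockComb v g - w)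
    have h3 := Wᗮ.norm_orthogonalProjectionOnto_apply_le (blockComb (v - u) g)
    have h4 := norm_blockComb_le (v - u) g
    have h5 : ‖g‖ ≤ √(Fintype.card κ) * √(Fintype.card ι) / ε := by
      apply le_of_sq_le_sq _ (by positivity)
      rw [div_pow, mul_pow, Real.sq_sqrt (by positivity), Real.sq_sqrt (by positivity)]
      exact hg
    have h6 : ‖v - u‖ * ‖g‖ ≤ ε * √(Fintype.card ι) := by
      refine (mul_le_mul hvz h5 (norm_nonneg _) (by positivity)).trans ?_
      have : √(Fintype.card κ : ℝ) / K * (√(Fintype.card κ) * √(Fintype.card ι) / ε)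
          = (Fintype.card κ / (K * ε)) * √(Fintype.card ι) := by
        rw [div_mul_div_comm, ← mul_assoc, Real.mul_self_sqrt (by positivity)]
        ring
      rw [this]
      refine mul_le_mul_of_nonneg_right ?_ (Real.sqrt_nonneg _)
      rw [div_le_iff₀ (by positivity)]
      linarith
    rw [h1]
    refine (norm_sub_le _ _).trans ?_
    linarith

/-- Small-ball estimate for coefficient vectors that are only approximately normalised. -/
lemma blockComb_smallBall_grid {W : Submodule ℝ (EuclideanSpace ℝ ι)}
    (hW : 2 * Module.finrank ℝ W ≤ Fintype.card ι) {u : EuclideanSpace ℝ κ} (hu : 1 / 2 ≤ ‖u‖)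
    {ε : ℝ} (hε : 0 < ε) :
    (stdGaussian (EuclideanSpace ℝ (κ × ι))).real
      {g | ‖Wᗮ.orthogonalProjectionOnto (blockComb u g)‖ ≤ 2 * ε * √(Fintype.card ι)}
      ≤ (12 * ε) ^ (Fintype.card ι - Module.finrank ℝ W) := by
  have hu0 : 0 < ‖u‖ := by linarith
  have h := blockComb_smallBall hW (v := ‖u‖⁻¹ • u)
    (by rw [norm_smul, norm_inv, norm_norm, inv_mul_cancel₀ hu0.ne'])
    (s := 4 * ε) (by positivity)
  refine (measureReal_mono ?_).trans (h.trans (le_of_eq (by ring_nf)))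
  intro g hg
  simp only [Set.mem_ofPred_eq] at hg ⊢
  rw [blockComb_smul, map_smul, norm_smul, norm_inv, norm_norm, inv_mul_le_iff₀ hu0]
  have : 0 ≤ ε * √(Fintype.card ι : ℝ) := by positivity
  nlinarith

/-- The constant in `stdGaussian_blockComb_near_le`; the fourth power compensates the exponent
`N / 4`. -/
def nearConst : ℝ := 200 ^ 4

/-- The union bound over the grid: the factors `6ᵏ kᵏ` are at most exponential in `N`, since
`k² ≤ N`, and the loss `ε^{-2k}` is covered by the small-ball exponent `N - d ≥ N / 2`. -/
lemma grid_union_bound_le {k N d : ℕ} {ε : ℝ} (hk : 0 < k) (hkN : k ^ 2 ≤ N) (hkN' : 8 * k ≤ N)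
    (hd : 2 * d ≤ N) (hε : 0 < ε) (hε1 : ε ≤ 1) :
    (6 * k / ε ^ 2 : ℝ) ^ k * (12 * ε) ^ (N - d) ≤ (nearConst * ε) ^ ((N : ℝ) / 4) := by
  have hk' : (k : ℝ) ^ k ≤ 2 ^ N := by
    have h1 : k ^ k ≤ (2 ^ k) ^ k := Nat.pow_le_pow_left Nat.lt_two_pow_self.le k
    rw [← pow_mul, ← sq] at h1
    exact_mod_cast h1.trans (Nat.pow_le_pow_right (by norm_num) hkN)
  have h6 : (6 : ℝ) ^ k ≤ 6 ^ N := pow_le_pow_right₀ (by norm_num) (by omega)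
  have h12 : (12 : ℝ) ^ (N - d) ≤ 12 ^ N := pow_le_pow_right₀ (by norm_num) (by omega)
  have hε' : ε ^ (N - d) = ε ^ (2 * k) * ε ^ (N - d - 2 * k) := by
    rw [← pow_add]; congr 1; omega
  have he : ε ^ (N - d - 2 * k) ≤ ε ^ ((N : ℝ) / 4) := by
    rw [← Real.rpow_natCast]
    apply Real.rpow_le_rpow_of_exponent_ge hε hε1
    rw [div_le_iff₀ (by norm_num)]
    have : N ≤ (N - d - 2 * k) * 4 := by omega
    exact_mod_cast this
  have hC : (nearConst * ε) ^ ((N : ℝ) / 4) = 200 ^ N * ε ^ ((N : ℝ) / 4) := by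
    rw [nearConst, Real.mul_rpow (by positivity) hε.le, ← Real.rpow_natCast 200 4,
      ← Real.rpow_mul (by norm_num), ← Real.rpow_natCast 200 N]
    congr 2
    push_cast; ring
  rw [hC]
  calc (6 * k / ε ^ 2 : ℝ) ^ k * (12 * ε) ^ (N - d)
      = 6 ^ k * (k : ℝ) ^ k * 12 ^ (N - d) * ε ^ (N - d - 2 * k) := by
        rw [div_pow, mul_pow, mul_pow, hε', ← pow_mul]
        field_simp
    _ ≤ 6 ^ N * 2 ^ N * 12 ^ N * ε ^ ((N : ℝ) / 4) := by gcongr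
    _ = 144 ^ N * ε ^ ((N : ℝ) / 4) := by rw [← mul_pow, ← mul_pow]; norm_num
    _ ≤ 200 ^ N * ε ^ ((N : ℝ) / 4) := by gcongr; norm_num

/-- **Smallest singular value of a tall Gaussian matrix modulo a subspace.** For `k` independent
standard Gaussian vectors in dimension `N ≫ k` and a subspace `W` of dimension at most `N / 2`, with
overwhelming probability every unit combination of the vectors has distance at least `ε √N`
from `W`. -/
theorem stdGaussian_blockComb_near_le [Nonempty κ] {W : Submodule ℝ (EuclideanSpace ℝ ι)}
    (hk : Fintype.card κ ^ 2 ≤ Fintype.card ι) (hk' : 8 * Fintype.card κ ≤ Fintype.card ι)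
    (hW : 2 * Module.finrank ℝ W ≤ Fintype.card ι) {ε : ℝ} (hε : 0 < ε) :
    (stdGaussian (EuclideanSpace ℝ (κ × ι))).real
      {g | ∃ v : EuclideanSpace ℝ κ, ‖v‖ = 1 ∧ ∃ w ∈ W,
        ‖blockComb v g - w‖ ≤ ε * √(Fintype.card ι)}
      ≤ 2 * (nearConst * ε) ^ ((Fintype.card ι : ℝ) / 4) := by
  rcases lt_or_ge 1 (nearConst * ε) with hC | hC
  · have : (1 : ℝ) ≤ (nearConst * ε) ^ ((Fintype.card ι : ℝ) / 4) :=
      Real.one_le_rpow hC.le (by positivity)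
    have h1 := measureReal_le_one (μ := stdGaussian (EuclideanSpace ℝ (κ × ι)))
      (s := {g | ∃ v : EuclideanSpace ℝ κ, ‖v‖ = 1 ∧ ∃ w ∈ W,
        ‖blockComb v g - w‖ ≤ ε * √(Fintype.card ι)})
    linarith
  have hε1 : ε ≤ 1 / 200 ^ 4 := by
    rw [le_div_iff₀ (by norm_num)]
    rw [nearConst] at hC; linarith
  have hε2 : ε ≤ 1 := hε1.trans (by norm_num)
  set k := Fintype.card κ with hkdef
  set N := Fintype.card ι with hNdef
  have hk1 : 1 ≤ k := Fintype.card_pos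
  have hk1' : (1 : ℝ) ≤ k := by exact_mod_cast hk1
  obtain ⟨K, hK, hK'⟩ : ∃ K : ℕ, (k : ℝ) / ε ^ 2 ≤ K ∧ (K : ℝ) ≤ 2 * (k / ε ^ 2) := by
    refine ⟨_, Nat.le_ceil _, ?_⟩
    have h1 : (1 : ℝ) ≤ k / ε ^ 2 := by
      rw [le_div_iff₀ (by positivity)]
      nlinarith
    have := Nat.ceil_lt_add_one (a := (k : ℝ) / ε ^ 2) (by positivity)
    linarith
  have hK2 : (4 : ℝ) ≤ k / ε ^ 2 := by
    rw [le_div_iff₀ (by positivity)]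
    have : ε ^ 2 ≤ (1 / 200 ^ 4) ^ 2 := pow_le_pow_left₀ hε.le hε1 2
    norm_num at this
    linarith
  have hK2' : 4 ≤ K := by exact_mod_cast hK2.trans hK
  set γ := stdGaussian (EuclideanSpace ℝ (κ × ι))
  set T : Finset (κ → ℤ) := gridIndex κ K
  have hsub : {g : EuclideanSpace ℝ (κ × ι) | ∃ v : EuclideanSpace ℝ κ, ‖v‖ = 1 ∧ ∃ w ∈ W,
        ‖blockComb v g - w‖ ≤ ε * √N} ⊆
      {g | (Module.finrank ℝ (EuclideanSpace ℝ (κ × ι)) : ℝ) / ε ^ 2 ≤ ‖g‖ ^ 2} ∪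
      ⋃ z ∈ T, {g | 1 / 2 ≤ ‖(gridPoint K z : EuclideanSpace ℝ κ)‖ ∧
        ‖Wᗮ.orthogonalProjectionOnto (blockComb (gridPoint K z) g)‖ ≤ 2 * ε * √N} := by
    rintro g ⟨v, hv, w, hw, h⟩
    rcases le_or_gt ((Module.finrank ℝ (EuclideanSpace ℝ (κ × ι)) : ℝ) / ε ^ 2) (‖g‖ ^ 2)
      with hg | hg
    · exact Or.inl hg
    · right
      rw [finrank_euclideanSpace, Fintype.card_prod, Nat.cast_mul] at hg
      obtain ⟨z, hz, h1, h2⟩ := exists_grid_blockComb_near hε hε2 hK hK2' hg.le hv hw h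
      exact Set.mem_biUnion hz ⟨h1, h2⟩
  have hpt : ∀ z ∈ T, γ.real {g | 1 / 2 ≤ ‖(gridPoint K z : EuclideanSpace ℝ κ)‖ ∧
        ‖Wᗮ.orthogonalProjectionOnto (blockComb (gridPoint K z) g)‖ ≤ 2 * ε * √N}
      ≤ (12 * ε) ^ (N - Module.finrank ℝ W) := by
    intro z _
    by_cases hz : 1 / 2 ≤ ‖(gridPoint K z : EuclideanSpace ℝ κ)‖
    · refine (measureReal_mono ?_).trans (blockComb_smallBall_grid hW hz hε)
      exact fun g hg => hg.2
    · simp only [hz, false_and, Set.ofPred_false, measureReal_empty]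
      positivity
  have hcard : (T.card : ℝ) ≤ (6 * k / ε ^ 2) ^ k := by
    rw [card_gridIndex, ← hkdef]
    push_cast
    refine pow_le_pow_left₀ (by positivity) ?_ k
    have h2K : (4 : ℝ) ≤ K := by exact_mod_cast hK2'
    have : 6 * (k : ℝ) / ε ^ 2 = 3 * (2 * (k / ε ^ 2)) := by ring
    linarith
  have hgrid : γ.real (⋃ z ∈ T, {g | 1 / 2 ≤ ‖(gridPoint K z : EuclideanSpace ℝ κ)‖ ∧
        ‖Wᗮ.orthogonalProjectionOnto (blockComb (gridPoint K z) g)‖ ≤ 2 * ε * √N})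
      ≤ (nearConst * ε) ^ ((N : ℝ) / 4) := by
    refine (measureReal_biUnion_finset_le _ _).trans ((Finset.sum_le_sum hpt).trans ?_)
    rw [Finset.sum_const, nsmul_eq_mul]
    refine le_trans ?_ (grid_union_bound_le hk1 hk hk' hW hε hε2)
    gcongr
  have htail : γ.real {g | (Module.finrank ℝ (EuclideanSpace ℝ (κ × ι)) : ℝ) / ε ^ 2 ≤ ‖g‖ ^ 2}
      ≤ (nearConst * ε) ^ ((N : ℝ) / 4) := by
    refine (stdGaussian_norm_tail hε).trans ?_
    rw [finrank_euclideanSpace, Fintype.card_prod]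
    have h6 : 6 * ε ^ 2 ≤ nearConst * ε := by rw [nearConst]; nlinarith
    rw [← Real.rpow_natCast]
    refine (Real.rpow_le_rpow (by positivity) h6 (by positivity)).trans ?_
    apply Real.rpow_le_rpow_of_exponent_ge (by rw [nearConst]; positivity) hC
    have : (N : ℝ) * 1 ≤ N * k := by gcongr
    push_cast
    have : (0 : ℝ) ≤ N := by positivity
    nlinarith
  refine (measureReal_mono hsub).trans ((measureReal_union_le _ _).trans ?_)
  linarith

/-- The version of `stdGaussian_blockComb_near_le` for Gaussian vectors with arbitrary means `M i`
and standard deviation `ρ`. The means are absorbed into the subspace. -/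
theorem stdGaussian_shifted_near_le [Nonempty κ] {W : Submodule ℝ (EuclideanSpace ℝ ι)}
    (M : κ → EuclideanSpace ℝ ι)
    (hk : Fintype.card κ ^ 2 ≤ Fintype.card ι) (hk' : 8 * Fintype.card κ ≤ Fintype.card ι)
    (hW : 2 * (Module.finrank ℝ W + Fintype.card κ) ≤ Fintype.card ι)
    {ε ρ : ℝ} (hε : 0 < ε) (hρ : 0 < ρ) :
    (stdGaussian (EuclideanSpace ℝ (κ × ι))).real
      {g | ∃ v : EuclideanSpace ℝ κ, ‖v‖ = 1 ∧ ∃ w ∈ W,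
        ‖∑ i, v i • M i + ρ • blockComb v g - w‖ ≤ ε * ρ * √(Fintype.card ι)}
      ≤ 2 * (nearConst * ε) ^ ((Fintype.card ι : ℝ) / 4) := by
  have hdim : 2 * Module.finrank ℝ (W ⊔ Submodule.span ℝ (Set.range M) :
      Submodule ℝ (EuclideanSpace ℝ ι)) ≤ Fintype.card ι := by
    have h1 := Submodule.finrank_add_le_finrank_add_finrank W (Submodule.span ℝ (Set.range M))
    have h2 := finrank_range_le_card (R := ℝ) M
    rw [Set.finrank] at h2
    omega
  refine (measureReal_mono ?_).trans (stdGaussian_blockComb_near_le hk hk' hdim hε)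
  rintro g ⟨v, hv, w, hw, h⟩
  refine ⟨v, hv, ρ⁻¹ • (w - ∑ i, v i • M i), ?_, ?_⟩
  · refine Submodule.smul_mem _ _ (Submodule.sub_mem _ (Submodule.mem_sup_left hw) ?_)
    refine Submodule.mem_sup_right (Submodule.sum_mem _ fun i _ => Submodule.smul_mem _ _ ?_)
    exact Submodule.subset_span ⟨i, rfl⟩
  · have : blockComb v g - ρ⁻¹ • (w - ∑ i, v i • M i)
        = ρ⁻¹ • (∑ i, v i • M i + ρ • blockComb v g - w) := by
      rw [smul_sub, smul_sub, smul_add, inv_smul_smul₀ hρ.ne']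
      abel
    rw [this, norm_smul, norm_inv, Real.norm_of_nonneg hρ.le, inv_mul_le_iff₀ hρ]
    linarith

end

/-! ### Fourth moments of Gaussian mixtures -/

open scoped RealInnerProductSpace

lemma integral_pow_four_gaussianReal (v : NNReal) :
    ∫ x, x ^ 4 ∂(gaussianReal 0 v) = 3 * (v : ℝ) ^ 2 := by
  have h := iteratedDeriv_mgf_zero (X := fun x : ℝ => x) (μ := gaussianReal 0 v)
    (by simp [integrableExpSet_fun_id_gaussianReal]) 4
  have hint : ∫ x, x ^ 4 ∂(gaussianReal 0 v)
    = ∫ x, ((fun x : ℝ => x) ^ 4) x ∂(gaussianReal 0 v) := rfl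
  rw [hint, ← h, mgf_fun_id_gaussianReal]
  set c : ℝ := (v : ℝ)
  have hd (t : ℝ) : HasDerivAt (fun t : ℝ => Real.exp (0 * t + c * t ^ 2 / 2))
      (c * t * Real.exp (0 * t + c * t ^ 2 / 2)) t := by
    have h1 : HasDerivAt (fun t : ℝ => 0 * t + c * t ^ 2 / 2) (c * t) t := by
      have := (((hasDerivAt_id t).const_mul 0).add
        ((((hasDerivAt_id t).pow 2).const_mul c).div_const 2))
      convert! this using 1
      simp; ring
    convert! h1.exp using 1
    ring
  have step (p q : ℝ → ℝ) (hq : ∀ t, HasDerivAt p (q t) t) :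
      deriv (fun t : ℝ => p t * Real.exp (0 * t + c * t ^ 2 / 2))
        = fun t => (q t + p t * (c * t)) * Real.exp (0 * t + c * t ^ 2 / 2) := by
    ext t
    rw [((hq t).fun_mul (hd t)).deriv]
    ring
  have e0 : (fun t : ℝ => Real.exp (0 * t + c * t ^ 2 / 2))
      = fun t => (fun _ : ℝ => (1 : ℝ)) t * Real.exp (0 * t + c * t ^ 2 / 2) := by simp
  rw [iteratedDeriv_succ', iteratedDeriv_succ', iteratedDeriv_succ', iteratedDeriv_one, e0,
    step (fun _ => 1) (fun _ => 0) (fun t => hasDerivAt_const t 1),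
    step (fun t => 0 + 1 * (c * t)) (fun _ => c) (fun t => by
      have := (((hasDerivAt_id t).const_mul c).const_mul 1).const_add 0
      simpa using this),
    step (fun t => c + (0 + 1 * (c * t)) * (c * t)) (fun t => 2 * c ^ 2 * t) (fun t => by
      have := ((hasDerivAt_id t).pow 2).const_mul (c ^ 2) |>.const_add c
      convert! this using 1
      · ext t; simp; ring
      · simp; ring),
    step (fun t => 2 * c ^ 2 * t + (c + (0 + 1 * (c * t)) * (c * t)) * (c * t))
      (fun t => 3 * c ^ 2 + 3 * c ^ 3 * t ^ 2) (fun t => by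
      have := ((hasDerivAt_id t).const_mul (3 * c ^ 2)).add
        (((hasDerivAt_id t).pow 3).const_mul (c ^ 3))
      convert! this using 1
      · ext t; simp; ring
      · simp; ring)]
  simp

section
variable {ι : Type*} [Fintype ι] [DecidableEq ι] {C : Matrix ι ι ℝ}

lemma map_inner_multivariateGaussian (hC : C.PosSemidef) (u : EuclideanSpace ℝ ι) :
    (multivariateGaussian 0 C).map (fun x => ⟪u, x⟫)
      = gaussianReal 0 (Real.toNNReal (u ⬝ᵥ C.mulVec u)) := by
  have h := IsGaussian.map_eq_gaussianReal (μ := multivariateGaussian 0 C) (innerSL ℝ u)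
  have h1 : ∫ x, innerSL ℝ u x ∂(multivariateGaussian 0 C) = 0 := by
    rw [ContinuousLinearMap.integral_comp_id_comm IsGaussian.integrable_id,
      integral_id_multivariateGaussian, map_zero]
  have h2 : Var[innerSL ℝ u; multivariateGaussian 0 C] = u ⬝ᵥ C.mulVec u := by
    rw [← covarianceBilin_multivariateGaussian (μ := 0) hC,
      covarianceBilin_self IsGaussian.memLp_two_id]
    rfl
  rw [h1, h2] at h
  exact h

lemma integral_inner_pow_four_multivariateGaussian (hC : C.PosSemidef) (u : EuclideanSpace ℝ ι) :
    ∫ x, ⟪u, x⟫ ^ 4 ∂(multivariateGaussian 0 C) = 3 * (u ⬝ᵥ C.mulVec u) ^ 2 := by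
  have h := integral_map (μ := multivariateGaussian 0 C) (φ := fun x => ⟪u, x⟫)
    (f := fun y : ℝ => y ^ 4) (by fun_prop) (by fun_prop)
  have h0 : 0 ≤ u ⬝ᵥ C.mulVec u := by
    simpa using hC.dotProduct_mulVec_nonneg u
  rw [← h, map_inner_multivariateGaussian hC, integral_pow_four_gaussianReal, Real.coe_toNNReal _ h0]

lemma integrable_inner_pow_four_multivariateGaussian (u : EuclideanSpace ℝ ι) :
    Integrable (fun x => ⟪u, x⟫ ^ 4) (multivariateGaussian 0 C) := by
  have h := IsGaussian.memLp_dual (multivariateGaussian 0 C) (innerSL ℝ u) 4 (by simp)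
  have := h.integrable_norm_pow (p := 4) (by norm_num)
  refine this.congr (Filter.Eventually.of_forall fun x => ?_)
  simp [Even.pow_abs (show Even 4 by decide)]

/-- The vector `e_a ± e_b ± e_c ± e_d` with the given signs. -/
noncomputable def signedSum (a b c d : ι) (s : Bool × Bool × Bool) : EuclideanSpace ℝ ι :=
  WithLp.toLp 2 (Pi.single a 1 + (if s.1 then (1 : ℝ) else -1) • Pi.single b 1
    + (if s.2.1 then (1 : ℝ) else -1) • Pi.single c 1
    + (if s.2.2 then (1 : ℝ) else -1) • Pi.single d 1)

lemma inner_signedSum (a b c d : ι) (s : Bool × Bool × Bool) (x : EuclideanSpace ℝ ι) :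
    ⟪signedSum a b c d s, x⟫ = x a + (if s.1 then (1 : ℝ) else -1) * x b
      + (if s.2.1 then (1 : ℝ) else -1) * x c + (if s.2.2 then (1 : ℝ) else -1) * x d := by
  rw [← WithLp.toLp_ofLp 2 x, signedSum, EuclideanSpace.inner_toLp_toLp]
  simp only [dotProduct_add, dotProduct_smul, star_trivial, dotProduct_single_one, smul_eq_mul]

/-- **Isserlis' theorem** for fourth moments, by polarization from the fourth moments of
one-dimensional marginals. -/
theorem integral_mul_four_multivariateGaussian (hC : C.PosSemidef) (a b c d : ι) :
    Integrable (fun x : EuclideanSpace ℝ ι => x a * x b * x c * x d) (multivariateGaussian 0 C) ∧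
    ∫ x, x a * x b * x c * x d ∂(multivariateGaussian 0 C)
      = C a b * C c d + C a c * C b d + C a d * C b c := by
  have hpol : (fun x : EuclideanSpace ℝ ι => x a * x b * x c * x d)
      = fun x => ∑ s : Bool × Bool × Bool, ((if s.1 then (1 : ℝ) else -1) *
        (if s.2.1 then (1 : ℝ) else -1) * (if s.2.2 then (1 : ℝ) else -1) / 192) *
          ⟪signedSum a b c d s, x⟫ ^ 4 := by
    ext x
    simp only [inner_signedSum, Fintype.sum_prod_type, Fintype.sum_bool, if_true,
      Bool.false_eq_true, if_false]
    ring
  have hint (s : Bool × Bool × Bool) :=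
    (integrable_inner_pow_four_multivariateGaussian (C := C) (signedSum a b c d s)).const_mul
      ((if s.1 then (1 : ℝ) else -1) *
        (if s.2.1 then (1 : ℝ) else -1) * (if s.2.2 then (1 : ℝ) else -1) / 192)
  rw [hpol]
  refine ⟨integrable_finsetSum _ fun s _ => hint s, ?_⟩
  rw [integral_finsetSum _ fun s _ => hint s]
  simp only [integral_const_mul, integral_inner_pow_four_multivariateGaussian hC]
  have hs (i j : ι) : C i j = C j i := by simpa using hC.1.apply j i
  simp only [signedSum, Matrix.mulVec_add, Matrix.mulVec_smul, Matrix.mulVec_single_one,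
    dotProduct_add, add_dotProduct, smul_dotProduct, dotProduct_smul, single_one_dotProduct,
    Matrix.col_apply, smul_eq_mul, Fintype.sum_prod_type, Fintype.sum_bool, if_true,
    Bool.false_eq_true, if_false]
  rw [hs b a, hs c a, hs d a, hs c b, hs d b, hs d c]
  ring

end

/-- The fourth moment tensor of a zero-mean Gaussian mixture. -/
lemma fourthMoment_eq {n k : ℕ} {w : Fin k → ℝ} (hw : ∀ i, 0 ≤ w i)
    {C : Fin k → Matrix (Fin n) (Fin n) ℝ} (hC : ∀ i, (C i).PosSemidef) (a b c d : Fin n) :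
    fourthMoment w C a b c d
      = ∑ i, w i * (C i a b * C i c d + C i a c * C i b d + C i a d * C i b c) := by
  rw [fourthMoment, mixtureLaw, integral_finsetSum_measure]
  · refine Finset.sum_congr rfl fun i _ => ?_
    rw [integral_smul_measure, (integral_mul_four_multivariateGaussian (hC i) a b c d).2,
      ENNReal.toReal_ofReal (hw i), smul_eq_mul]
  · intro i _
    exact (integral_mul_four_multivariateGaussian (hC i) a b c d).1.smul_measure (by simp)

section
variable {n k : ℕ}

lemma projPerp_sum_smul {α : Type*} (S : Submodule ℝ (EuclideanSpace ℝ (Fin n))) (s : Finset α)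
    (c : α → ℝ) (A : α → Matrix (Fin n) (Fin n) ℝ) :
    projPerp S (∑ i ∈ s, c i • A i) = ∑ i ∈ s, c i • projPerp S (A i) := by
  ext a b
  have : WithLp.toLp 2 ((∑ i ∈ s, c i • A i).col b)
      = ∑ i ∈ s, c i • (WithLp.toLp 2 ((A i).col b) : EuclideanSpace ℝ (Fin n)) := by
    ext r
    simp [Matrix.col_apply, Matrix.sum_apply]
  simp only [projPerp, Matrix.of_apply, this, map_sum, map_smul, Matrix.sum_apply,
    Matrix.smul_apply, WithLp.ofLp_sum, WithLp.ofLp_smul, Finset.sum_apply, Pi.smul_apply]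

lemma projPerp_add (S : Submodule ℝ (EuclideanSpace ℝ (Fin n)))
    (A B : Matrix (Fin n) (Fin n) ℝ) : projPerp S (A + B) = projPerp S A + projPerp S B := by
  ext a b
  have : WithLp.toLp 2 ((A + B).col b)
      = (WithLp.toLp 2 (A.col b) + WithLp.toLp 2 (B.col b) : EuclideanSpace ℝ (Fin n)) := by
    ext r
    simp [Matrix.col_apply]
  simp only [projPerp, Matrix.of_apply, this, map_add, Matrix.add_apply, PiLp.add_apply]

lemma projPerp_vecMulVec {S : Submodule ℝ (EuclideanSpace ℝ (Fin n))} {u : Fin n → ℝ}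
    (hu : WithLp.toLp 2 u ∈ S) (v : Fin n → ℝ) : projPerp S (Matrix.vecMulVec u v) = 0 := by
  ext a b
  have : WithLp.toLp 2 ((Matrix.vecMulVec u v).col b)
      = (v b • WithLp.toLp 2 u : EuclideanSpace ℝ (Fin n)) := by
    ext r
    simp [Matrix.col_apply, Matrix.vecMulVec_apply, mul_comm]
  simp only [projPerp, Matrix.of_apply, this, map_smul,
    Submodule.starProjection_orthogonal_apply_eq_zero hu, smul_zero, Matrix.zero_apply,
    PiLp.zero_apply]

/-- Projecting onto `S^⊥` kills the rank-one terms of the slices of the fourth moment, and the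
slices become combinations of the projected covariances. -/
lemma projPerp_momentSlice {w : Fin k → ℝ} (hw : ∀ i, 0 ≤ w i)
    {C : Fin k → Matrix (Fin n) (Fin n) ℝ} (hC : ∀ i, (C i).PosSemidef) {H : Finset (Fin n)}
    {j₁ j₂ : Fin n} (h₁ : j₁ ∈ H) (h₂ : j₂ ∈ H) :
    projPerp (columnSpan C H) (momentSlice w C j₁ j₂)
      = ∑ i, (w i * C i j₁ j₂) • projPerp (columnSpan C H) (C i) := by
  have hs (i : Fin k) (a b : Fin n) : C i a b = C i b a := by simpa using (hC i).1.apply b a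
  have hmem (i : Fin k) {j : Fin n} (hj : j ∈ H) :
      (WithLp.toLp 2 ((C i).col j) : EuclideanSpace ℝ (Fin n)) ∈ columnSpan C H :=
    Submodule.subset_span ⟨i, j, hj, rfl⟩
  have h : momentSlice w C j₁ j₂ = ∑ i, (w i * C i j₁ j₂) • C i
      + ∑ i, w i • (Matrix.vecMulVec ((C i).col j₁) ((C i).col j₂)
          + Matrix.vecMulVec ((C i).col j₂) ((C i).col j₁)) := by
    ext a b
    simp only [momentSlice, Matrix.of_apply, fourthMoment_eq hw hC, Matrix.add_apply,
      Matrix.sum_apply, Matrix.smul_apply, smul_eq_mul, Matrix.vecMulVec_apply, Matrix.col_apply]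
    rw [← Finset.sum_add_distrib]
    refine Finset.sum_congr rfl fun i _ => ?_
    rw [hs i a j₁, hs i a j₂, hs i b j₁, hs i b j₂]
    ring
  rw [h, projPerp_add, projPerp_sum_smul, projPerp_sum_smul]
  simp only [projPerp_add, projPerp_vecMulVec (hmem _ h₁), projPerp_vecMulVec (hmem _ h₂),
    add_zero, smul_zero, Finset.sum_const_zero]

end

/-! ### Singular values of a product -/

section
open scoped RealInnerProductSpace
variable {E F Y : Type*} [NormedAddCommGroup E] [InnerProductSpace ℝ E] [FiniteDimensional ℝ E]
  [NormedAddCommGroup F] [InnerProductSpace ℝ F] [FiniteDimensional ℝ F]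
  [NormedAddCommGroup Y] [InnerProductSpace ℝ Y] [FiniteDimensional ℝ Y]

/-- The easy half of the min-max characterisation of singular values. -/
lemma le_singularValues_of_le_norm (T : E →ₗ[ℝ] F) {V : Submodule ℝ E} {r : ℕ}
    (hV : r < Module.finrank ℝ V) {c : ℝ} (h : ∀ x ∈ V, c * ‖x‖ ≤ ‖T x‖) :
    c ≤ T.singularValues r := by
  have hr : r < Module.finrank ℝ E := hV.trans_le V.finrank_le
  set hT := T.isSymmetric_adjoint_comp_self
  set b := hT.eigenvectorBasis rfl
  -- a nonzero vector of `V` orthogonal to the first `r` right singular vectors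
  let f : V →ₗ[ℝ] (Fin r → ℝ) := LinearMap.pi fun i =>
    ((innerSL ℝ (b ⟨i, i.2.trans hr⟩)).toLinearMap).comp V.subtype
  have hker : LinearMap.ker f ≠ ⊥ := LinearMap.ker_ne_bot_of_finrank_lt (by simpa using hV)
  obtain ⟨x, hx, hx0⟩ := (Submodule.ne_bot_iff _).1 hker
  have hxi (i : Fin (Module.finrank ℝ E)) (hi : (i : ℕ) < r) : ⟪b i, (x : E)⟫ = 0 := by
    have := congrFun (LinearMap.mem_ker.1 hx) ⟨i, hi⟩
    simpa [f] using this
  have hnorm : ‖T x‖ ^ 2 ≤ T.singularValues r ^ 2 * ‖(x : E)‖ ^ 2 := by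
    have h1 : ‖T x‖ ^ 2 = ∑ i, hT.eigenvalues rfl i * ⟪b i, (x : E)⟫ ^ 2 := by
      rw [← real_inner_self_eq_norm_sq, ← LinearMap.adjoint_inner_left, ← LinearMap.comp_apply,
        ← b.sum_inner_mul_inner]
      refine Finset.sum_congr rfl fun i _ => ?_
      have h2 : ⟪(T.adjoint ∘ₗ T) x, b i⟫ = hT.eigenvalues rfl i * ⟪(x : E), b i⟫ := by
        rw [hT, hT.apply_eigenvectorBasis rfl i, real_inner_smul_right]
        rfl
      rw [h2, real_inner_comm]
      ring
    rw [h1, ← b.sum_sq_inner_right, Finset.mul_sum, T.sq_singularValues_of_lt rfl hr]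
    refine Finset.sum_le_sum fun i _ => ?_
    rcases lt_or_ge (i : ℕ) r with hi | hi
    · simp [hxi i hi]
    · exact mul_le_mul_of_nonneg_right (hT.eigenvalues_antitone rfl hi) (sq_nonneg _)
  have hx0' : 0 < ‖(x : E)‖ := norm_pos_iff.2 (by simpa using hx0)
  have h3 : ‖T x‖ ≤ T.singularValues r * ‖(x : E)‖ := le_of_sq_le_sq (by rw [mul_pow]; exact hnorm)
    (mul_nonneg (T.singularValues_nonneg r) hx0'.le)
  exact le_of_mul_le_mul_right ((h x x.2).trans h3) hx0'

omit [FiniteDimensional ℝ F] in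
/-- A product `A D Bᵀ` is bounded below on the range of `B`. -/
lemma le_norm_comp_adjoint {A : Y →ₗ[ℝ] F} {D : Y →ₗ[ℝ] Y} {B : Y →ₗ[ℝ] E} {α ω β : ℝ}
    (hα : 0 ≤ α) (hω : 0 ≤ ω) (hβ : 0 < β) (hA : ∀ y, α * ‖y‖ ≤ ‖A y‖)
    (hD : ∀ y, ω * ‖y‖ ≤ ‖D y‖) (hB : ∀ y, β * ‖y‖ ≤ ‖B y‖) {x : E}
    (hx : x ∈ LinearMap.range B) : α * ω * β * ‖x‖ ≤ ‖A (D (B.adjoint x))‖ := by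
  obtain ⟨y, rfl⟩ := hx
  have h1 : β * ‖B y‖ ≤ ‖B.adjoint (B y)‖ := by
    have h2 : ‖B y‖ ^ 2 ≤ ‖y‖ * ‖B.adjoint (B y)‖ := by
      rw [← real_inner_self_eq_norm_sq, ← LinearMap.adjoint_inner_right]
      exact real_inner_le_norm _ _
    rcases (norm_nonneg (B y)).eq_or_lt with h0 | h0
    · rw [← h0, mul_zero]; exact norm_nonneg _
    · refine le_of_mul_le_mul_right ?_ h0
      calc β * ‖B y‖ * ‖B y‖ = β * ‖B y‖ ^ 2 := by ring
        _ ≤ β * (‖y‖ * ‖B.adjoint (B y)‖) := by gcongr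
        _ = β * ‖y‖ * ‖B.adjoint (B y)‖ := by ring
        _ ≤ ‖B y‖ * ‖B.adjoint (B y)‖ := by gcongr; exact hB y
        _ = _ := mul_comm _ _
  calc α * ω * β * ‖B y‖ = α * (ω * (β * ‖B y‖)) := by ring
    _ ≤ α * (ω * ‖B.adjoint (B y)‖) := by gcongr
    _ ≤ α * ‖D (B.adjoint (B y))‖ := by gcongr; exact hD _
    _ ≤ _ := hA _

end

section
variable {ι κ : Type*} [Fintype ι] [Fintype κ] [DecidableEq κ] {k : ℕ}

lemma le_kthSingularValue_of_factorization (hk : 0 < k) {A : Matrix ι (Fin k) ℝ}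
    {B : Matrix κ (Fin k) ℝ} {w : Fin k → ℝ} {α ω β : ℝ} (hα : 0 ≤ α) (hω : 0 ≤ ω) (hβ : 0 < β)
    (hA : ∀ y, α * ‖y‖ ≤ ‖Matrix.toEuclideanLin A y‖) (hw : ∀ i, ω ≤ w i)
    (hB : ∀ y, β * ‖y‖ ≤ ‖Matrix.toEuclideanLin B y‖) :
    α * ω * β ≤ kthSingularValue (A * Matrix.diagonal w * B.transpose) k := by
  classical
  set Bl := Matrix.toEuclideanLin B with hBl
  have hinj : Function.Injective Bl := by
    rw [← LinearMap.ker_eq_bot, LinearMap.ker_eq_bot']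
    intro y hy
    have := hB y
    rw [hy, norm_zero] at this
    have h2 : ‖y‖ ≤ 0 := by
      by_contra hc
      push Not at hc
      nlinarith
    simpa using h2
  have hrank : Module.finrank ℝ (LinearMap.range Bl) = k := by
    rw [LinearMap.finrank_range_of_inj hinj, finrank_euclideanSpace, Fintype.card_fin]
  have hD : ∀ y, ω * ‖y‖ ≤ ‖Matrix.toEuclideanLin (Matrix.diagonal w) y‖ := by
    intro y
    apply le_of_sq_le_sq _ (norm_nonneg _)
    rw [mul_pow, EuclideanSpace.real_norm_sq_eq, EuclideanSpace.real_norm_sq_eq, Finset.mul_sum]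
    refine Finset.sum_le_sum fun i _ => ?_
    rw [← mul_pow]
    simp only [Matrix.toLpLin_apply, Matrix.mulVec_diagonal]
    rw [mul_pow, mul_pow]
    exact mul_le_mul_of_nonneg_right (pow_le_pow_left₀ hω (hw i) 2) (sq_nonneg _)
  have hfac (x : EuclideanSpace ℝ κ) :
      Matrix.toEuclideanLin (A * Matrix.diagonal w * B.transpose) x
        = Matrix.toEuclideanLin A (Matrix.toEuclideanLin (Matrix.diagonal w) (Bl.adjoint x)) := by
    rw [hBl, ← Matrix.toEuclideanLin_conjTranspose_eq_adjoint,
      Matrix.conjTranspose_eq_transpose_of_trivial]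
    simp [Matrix.toLpLin_apply, Matrix.mulVec_mulVec, Matrix.mul_assoc]
  refine le_singularValues_of_le_norm _ (V := LinearMap.range Bl) (by omega) ?_
  intro x hx
  rw [hfac]
  exact le_norm_comp_adjoint hα hω hβ hA hD hB hx

/-- If a product `A R` whose left factor has `k` columns has nonzero `k`-th singular value,
then it has the same column span as `A`. -/
lemma span_col_mul_eq_of_kthSingularValue_pos (hk : 0 < k) (A : Matrix ι (Fin k) ℝ)
    (R : Matrix (Fin k) κ ℝ) (h : 0 < kthSingularValue (A * R) k) :
    Submodule.span ℝ (Set.range (A * R).col) = Submodule.span ℝ (Set.range A.col) := by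
  classical
  rw [← Matrix.range_mulVecLin, ← Matrix.range_mulVecLin]
  apply Submodule.eq_of_le_of_finrank_le
  · rw [Matrix.mulVecLin_mul]
    exact LinearMap.range_comp_le_range _ _
  · have h1 : A.rank ≤ k := by simpa using A.rank_le_card_width
    rw [kthSingularValue, LinearMap.singularValues_pos_iff_lt_finrank_range] at h
    have h2 : (A * R).rank = Module.finrank ℝ (LinearMap.range (Matrix.toEuclideanLin (A * R))) := by
      rw [Matrix.rank_eq_finrank_range_toLin (A * R) (PiLp.basisFun 2 ℝ ι) (PiLp.basisFun 2 ℝ κ),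
        ← Matrix.toLpLin_eq_toLin]
    change A.rank ≤ (A * R).rank
    omega

end

/-! ### Factorization of `Q_{U_S}` -/

noncomputable section
variable {n k : ℕ}

/-- The matrix whose columns are the vectors `vec (Proj_{S^⊥} C⁽ⁱ⁾)`. -/
def projectedCov (C : Fin k → Matrix (Fin n) (Fin n) ℝ) (H : Finset (Fin n)) :
    Matrix (Fin n × Fin n) (Fin k) ℝ :=
  Matrix.of fun r i => Matrix.vec (projPerp (columnSpan C H) (C i)) r

/-- The matrix whose columns are the vectors of entries of `C⁽ⁱ⁾` with row and column in `H`, each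
symmetric pair of entries being listed once. -/
def sampledCov (C : Fin k → Matrix (Fin n) (Fin n) ℝ) (H : Finset (Fin n)) :
    Matrix {p : Fin n × Fin n // p.1 ≤ p.2 ∧ p.1 ∈ H ∧ p.2 ∈ H} (Fin k) ℝ :=
  Matrix.of fun p i => C i p.1.1 p.1.2

lemma matrixQUS_eq {w : Fin k → ℝ} (hw : ∀ i, 0 ≤ w i)
    {C : Fin k → Matrix (Fin n) (Fin n) ℝ} (hC : ∀ i, (C i).PosSemidef) (H : Finset (Fin n)) :
    matrixQUS w C H
      = projectedCov C H * Matrix.diagonal w * (sampledCov C H).transpose := by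
  ext r p
  rw [matrixQUS, Matrix.of_apply, Matrix.vec, projPerp_momentSlice hw hC p.2.2.1 p.2.2.2,
    Matrix.sum_apply, Matrix.mul_apply]
  refine Finset.sum_congr rfl fun i _ => ?_
  simp only [Matrix.smul_apply, smul_eq_mul, Matrix.mul_diagonal, Matrix.transpose_apply,
    sampledCov, projectedCov, Matrix.of_apply, Matrix.vec]
  ring

lemma mem_columnSpan {C : Fin k → Matrix (Fin n) (Fin n) ℝ} {H : Finset (Fin n)}
    {y : EuclideanSpace ℝ (Fin n)} (hy : y ∈ columnSpan C H) :
    ∃ l : Fin k → H → ℝ, ∀ a, y a = ∑ i, ∑ j, l i j * C i a j := by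
  have hset : {v : EuclideanSpace ℝ (Fin n) | ∃ i, ∃ j ∈ H, v = WithLp.toLp 2 ((C i).col j)}
      = Set.range fun p : Fin k × H =>
        (WithLp.toLp 2 ((C p.1).col p.2) : EuclideanSpace ℝ (Fin n)) := by
    ext v
    constructor
    · rintro ⟨i, j, hj, rfl⟩
      exact ⟨(i, ⟨j, hj⟩), rfl⟩
    · rintro ⟨p, rfl⟩
      exact ⟨p.1, p.2, p.2.2, rfl⟩
  rw [columnSpan, hset, Submodule.mem_span_range_iff_exists_fun] at hy
  obtain ⟨c, rfl⟩ := hy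
  refine ⟨fun i j => c (i, j), fun a => ?_⟩
  simp [Fintype.sum_prod_type, Matrix.col_apply]

/-- The norm of a combination of the projected covariances is at least the distance of its
restriction to a block `I × J` from the restricted columns that span `S`. -/
lemma le_norm_projectedCov {C : Fin k → Matrix (Fin n) (Fin n) ℝ} {H I J : Finset (Fin n)}
    {v : EuclideanSpace ℝ (Fin k)} {s : ℝ}
    (h : ∀ l : Fin k → H → J → ℝ, s ≤ ‖(WithLp.toLp 2 fun p : I × J =>
      ∑ i, v i * C i p.1 p.2 - ∑ i, ∑ j, l i j p.2 * C i p.1 j : EuclideanSpace ℝ (I × J))‖) :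
    s ≤ ‖Matrix.toEuclideanLin (projectedCov C H) v‖ := by
  set S := columnSpan C H
  set x : Fin n → EuclideanSpace ℝ (Fin n) := fun b => WithLp.toLp 2 fun a => ∑ i, v i * C i a b
    with hx
  have hproj (b : Fin n) (a : Fin n) :
      (Matrix.toEuclideanLin (projectedCov C H) v) (b, a) = (x b - S.starProjection (x b)) a := by
    have h1 : x b = ∑ i, v i • (WithLp.toLp 2 ((C i).col b) : EuclideanSpace ℝ (Fin n)) := by
      ext r
      simp [hx, Matrix.col_apply]
    rw [← Submodule.starProjection_orthogonal_val, h1, map_sum]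
    simp only [map_smul, Matrix.toLpLin_apply, Matrix.mulVec, dotProduct, projectedCov,
      Matrix.of_apply, Matrix.vec, projPerp, WithLp.ofLp_sum, WithLp.ofLp_smul, Finset.sum_apply,
      Pi.smul_apply, smul_eq_mul, mul_comm]
    rfl
  choose l hl using fun b => mem_columnSpan (S.starProjection_apply_mem (x b))
  refine (h fun i j b => l b i j).trans ?_
  apply le_of_sq_le_sq _ (norm_nonneg _)
  rw [EuclideanSpace.real_norm_sq_eq, EuclideanSpace.real_norm_sq_eq, Fintype.sum_prod_type_right,
    Fintype.sum_prod_type]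
  have key (b a : Fin n) : (Matrix.toEuclideanLin (projectedCov C H) v) (b, a)
      = ∑ i, v i * C i a b - ∑ i, ∑ j, l b i j * C i a j := by
    rw [hproj, PiLp.sub_apply, hl]
  simp only [key]
  rw [Finset.sum_coe_sort J (fun b => ∑ a : I, (∑ i, v i * C i a b
    - ∑ i, ∑ j, l b i j * C i a j) ^ 2)]
  refine (Finset.sum_le_univ_sum_of_nonneg fun b => Finset.sum_nonneg fun a _ => sq_nonneg _).trans
    (Finset.sum_le_sum fun b _ => ?_)
  rw [Finset.sum_coe_sort I (fun a => (∑ i, v i * C i a b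
    - ∑ i, ∑ j, l b i j * C i a j) ^ 2)]
  exact Finset.sum_le_univ_sum_of_nonneg fun a => sq_nonneg _

/-- The pairs `a < b` of elements of `H`. -/
abbrev StrictPairs (H : Finset (Fin n)) := {p : Fin n × Fin n // p.1 < p.2 ∧ p.1 ∈ H ∧ p.2 ∈ H}

/-- Keeping only the off-diagonal positions decreases the norm of the sampled entries. -/
lemma le_norm_sampledCov {C : Fin k → Matrix (Fin n) (Fin n) ℝ} {H : Finset (Fin n)}
    {v : EuclideanSpace ℝ (Fin k)} {s : ℝ}
    (h : s ≤ ‖(WithLp.toLp 2 fun p : StrictPairs H => ∑ i, v i * C i p.1.1 p.1.2 :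
      EuclideanSpace ℝ (StrictPairs H))‖) :
    s ≤ ‖Matrix.toEuclideanLin (sampledCov C H) v‖ := by
  refine h.trans ?_
  apply le_of_sq_le_sq _ (norm_nonneg _)
  rw [EuclideanSpace.real_norm_sq_eq, EuclideanSpace.real_norm_sq_eq]
  let e : StrictPairs H ↪ {p : Fin n × Fin n // p.1 ≤ p.2 ∧ p.1 ∈ H ∧ p.2 ∈ H} :=
    ⟨fun p => ⟨p.1, p.2.1.le, p.2.2⟩, fun p q hpq => by
      have := congrArg Subtype.val hpq
      exact Subtype.ext this⟩
  have hkey (p : {p : Fin n × Fin n // p.1 ≤ p.2 ∧ p.1 ∈ H ∧ p.2 ∈ H}) :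
      (Matrix.toEuclideanLin (sampledCov C H) v) p = ∑ i, v i * C i p.1.1 p.1.2 := by
    simp [Matrix.toLpLin_apply, Matrix.mulVec, dotProduct, sampledCov, mul_comm]
  simp only [hkey]
  refine (Finset.sum_map Finset.univ e (fun p => (∑ i, v i * C i p.1.1 p.1.2) ^ 2)).symm.le.trans ?_
  exact Finset.sum_le_univ_sum_of_nonneg fun p => sq_nonneg _

lemma mul_norm_le_of_unit {F : Type*} [NormedAddCommGroup F] [NormedSpace ℝ F]
    (T : EuclideanSpace ℝ (Fin k) →ₗ[ℝ] F) {s : ℝ} (h : ∀ v, ‖v‖ = 1 → s ≤ ‖T v‖)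
    (y : EuclideanSpace ℝ (Fin k)) : s * ‖y‖ ≤ ‖T y‖ := by
  rcases (norm_nonneg y).eq_or_lt with h0 | h0
  · rw [← h0, mul_zero]; exact norm_nonneg _
  · have h1 := h (‖y‖⁻¹ • y) (by rw [norm_smul, norm_inv, norm_norm, inv_mul_cancel₀ h0.ne'])
    rwa [map_smul, norm_smul, norm_inv, norm_norm, le_inv_mul_iff₀ h0, mul_comm] at h1

/-- The deterministic part of the argument: lower bounds for the block of the covariances indexed by
`I × J` modulo the columns spanning `S`, and for the sampled entries, imply the conclusions about
`Q_{U_S}`. -/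
theorem matrixQUS_good (hk : 0 < k) {w : Fin k → ℝ} {ω₀ : ℝ} (hω : 0 < ω₀) (hw : ∀ i, ω₀ ≤ w i)
    {C : Fin k → Matrix (Fin n) (Fin n) ℝ} (hC : ∀ i, (C i).PosSemidef) {H I J : Finset (Fin n)}
    {α β : ℝ} (hα : 0 < α) (hβ : 0 < β)
    (hA : ∀ v : EuclideanSpace ℝ (Fin k), ‖v‖ = 1 → ∀ l : Fin k → H → J → ℝ,
      α ≤ ‖(WithLp.toLp 2 fun p : I × J =>
        ∑ i, v i * C i p.1 p.2 - ∑ i, ∑ j, l i j p.2 * C i p.1 j : EuclideanSpace ℝ (I × J))‖)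
    (hB : ∀ v : EuclideanSpace ℝ (Fin k), ‖v‖ = 1 →
      β ≤ ‖(WithLp.toLp 2 fun p : StrictPairs H => ∑ i, v i * C i p.1.1 p.1.2 :
        EuclideanSpace ℝ (StrictPairs H))‖) :
    α * ω₀ * β ≤ kthSingularValue (matrixQUS w C H) k ∧
      Submodule.span ℝ (Set.range (matrixQUS w C H).col)
        = Submodule.span ℝ (Set.range fun i => Matrix.vec (projPerp (columnSpan C H) (C i))) := by
  have hσ : α * ω₀ * β ≤ kthSingularValue (matrixQUS w C H) k := by
    rw [matrixQUS_eq (fun i => hω.le.trans (hw i)) hC H]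
    exact le_kthSingularValue_of_factorization hk hα.le hω.le hβ
      (mul_norm_le_of_unit _ fun v hv => le_norm_projectedCov (hA v hv)) hw
      (mul_norm_le_of_unit _ fun v hv => le_norm_sampledCov (hB v hv))
  refine ⟨hσ, ?_⟩
  have hpos : 0 < kthSingularValue (matrixQUS w C H) k := lt_of_lt_of_le (by positivity) hσ
  rw [matrixQUS_eq (fun i => hω.le.trans (hw i)) hC H, Matrix.mul_assoc] at hpos ⊢
  exact span_col_mul_eq_of_kthSingularValue_pos hk _ _ hpos

end

/-! ### Probability estimates for the noise -/

noncomputable section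
variable {n k : ℕ}

/-- The unordered position of an off-diagonal entry, as a pair above the diagonal. -/
def sortedPos {n : ℕ} (a b : Fin n) (h : a ≠ b) : {q : Fin n × Fin n // q.1 < q.2} :=
  ⟨(min a b, max a b), min_lt_max.2 h⟩

section
variable {Ω : Type*} [MeasurableSpace Ω] {P : Measure Ω} [IsProbabilityMeasure P] {ρ : ℝ}
  {Δ : Ω → Fin k → Matrix (Fin n) (Fin n) ℝ} {τ : Type*} [Fintype τ]

omit [IsProbabilityMeasure P] in
lemma IsSymmGaussianNoise.apply_eq_sorted (hΔ : IsSymmGaussianNoise P ρ Δ) (w : Ω) (i : Fin k)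
    {a b : Fin n} (h : a ≠ b) :
    Δ w i a b = Δ w i (sortedPos a b h).1.1 (sortedPos a b h).1.2 := by
  rcases h.lt_or_gt with h' | h'
  · simp [sortedPos, min_eq_left h'.le, max_eq_right h'.le]
  · simp only [sortedPos, min_eq_right h'.le, max_eq_left h'.le]
    exact ((hΔ.symm w i).apply a b).symm

/-- The noise at a family of distinct unordered off-diagonal positions, rescaled by `ρ`, consists of
independent standard Gaussian variables. -/
lemma IsSymmGaussianNoise.map_eq_pi (hΔ : IsSymmGaussianNoise P ρ Δ) (hρ : 0 < ρ)
    (e : τ → Fin k) (a b : τ → Fin n) (hab : ∀ t, a t ≠ b t)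
    (hinj : Function.Injective fun t => (e t, sortedPos (a t) (b t) (hab t))) :
    P.map (fun w t => Δ w (e t) (a t) (b t) / ρ) = Measure.pi fun _ : τ => gaussianReal 0 1 := by
  have hind : iIndepFun (fun (t : τ) (w : Ω) => Δ w (e t) (a t) (b t) / ρ) P := by
    have h := (hΔ.indep.precomp hinj).comp (fun _ x => x / ρ) (fun _ => by fun_prop)
    convert! h using 2 with t
    ext w
    simp only [Function.comp_apply]
    rw [hΔ.apply_eq_sorted w (e t) (hab t)]
  have hmeas (t : τ) : Measurable fun w => Δ w (e t) (a t) (b t) := hΔ.measurable _ _ _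
  rw [(iIndepFun_iff_map_fun_eq_pi_map fun t => ((hmeas t).div_const ρ).aemeasurable).1 hind]
  congr 1
  ext1 t
  have hlaw : P.map (fun w => Δ w (e t) (a t) (b t)) = gaussianReal 0 (Real.toNNReal (ρ ^ 2)) := by
    simp only [fun w => hΔ.apply_eq_sorted w (e t) (hab t)]
    exact hΔ.law _ _ _ (sortedPos _ _ (hab t)).2
  have hcomp : (fun w => Δ w (e t) (a t) (b t) / ρ)
      = (fun x => x / ρ) ∘ fun w => Δ w (e t) (a t) (b t) := rfl
  rw [hcomp, ← Measure.map_map (by fun_prop) (hmeas t), hlaw, gaussianReal_map_div_const]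
  congr 1
  · simp
  · ext
    have : ρ ^ 2 ≠ 0 := by positivity
    simp [Real.coe_toNNReal _ (sq_nonneg ρ), this]

lemma IsSymmGaussianNoise.map_eq_stdGaussian (hΔ : IsSymmGaussianNoise P ρ Δ) (hρ : 0 < ρ)
    (e : τ → Fin k) (a b : τ → Fin n) (hab : ∀ t, a t ≠ b t)
    (hinj : Function.Injective fun t => (e t, sortedPos (a t) (b t) (hab t))) :
    P.map (fun w => WithLp.toLp 2 fun t => Δ w (e t) (a t) (b t) / ρ)
      = stdGaussian (EuclideanSpace ℝ τ) := by
  have hmeas : Measurable fun w t => Δ w (e t) (a t) (b t) / ρ :=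
    measurable_pi_lambda _ fun t => (hΔ.measurable _ _ _).div_const ρ
  rw [← map_pi_eq_stdGaussian, ← hΔ.map_eq_pi hρ e a b hab hinj, Measure.map_map (by fun_prop) hmeas]
  rfl

lemma IsSymmGaussianNoise.map_eq_stdGaussian_prod {τ' : Type*} [Fintype τ']
    (hΔ : IsSymmGaussianNoise P ρ Δ) (hρ : 0 < ρ)
    (e : τ ⊕ τ' → Fin k) (a b : τ ⊕ τ' → Fin n) (hab : ∀ t, a t ≠ b t)
    (hinj : Function.Injective fun t => (e t, sortedPos (a t) (b t) (hab t))) :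
    P.map (fun w => ((WithLp.toLp 2 fun t => Δ w (e (.inl t)) (a (.inl t)) (b (.inl t)) / ρ,
        WithLp.toLp 2 fun t => Δ w (e (.inr t)) (a (.inr t)) (b (.inr t)) / ρ) :
          EuclideanSpace ℝ τ × EuclideanSpace ℝ τ'))
      = (stdGaussian (EuclideanSpace ℝ τ)).prod (stdGaussian (EuclideanSpace ℝ τ')) := by
  have hmeas : Measurable fun w t => Δ w (e t) (a t) (b t) / ρ :=
    measurable_pi_lambda _ fun t => (hΔ.measurable _ _ _).div_const ρ
  have h := measurePreserving_sumPiEquivProdPi (X := fun _ : τ ⊕ τ' => ℝ)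
    (fun _ => gaussianReal 0 1)
  rw [← map_pi_eq_stdGaussian, ← map_pi_eq_stdGaussian,
    Measure.map_prod_map _ _ (by fun_prop) (by fun_prop), ← h.map_eq,
    ← hΔ.map_eq_pi hρ e a b hab hinj, Measure.map_map h.measurable hmeas,
    Measure.map_map (by fun_prop) (h.measurable.comp hmeas)]
  rfl

end

section
variable {κ α β η : Type*} [Fintype κ] [Fintype α] [Fintype β] [Fintype η]

/-- A vector of column combinations: column `b` of the result is `∑ᵢⱼ l i j b • c i j`. -/
def columnComb (l : κ → η → β → ℝ) (c : κ → η → α → ℝ) : EuclideanSpace ℝ (α × β) :=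
  WithLp.toLp 2 fun p => ∑ i, ∑ j, l i j p.2 * c i j p.1

omit [Fintype α] in
/-- The matrices all of whose columns are combinations of the columns `c i j`, as a subspace. -/
lemma exists_submodule_columnComb (c : κ → η → α → ℝ) :
    ∃ W : Submodule ℝ (EuclideanSpace ℝ (α × β)),
      Module.finrank ℝ W ≤ Fintype.card κ * Fintype.card η * Fintype.card β ∧
      ∀ l : κ → η → β → ℝ, columnComb l c ∈ W := by
  let f : (κ × η × β → ℝ) →ₗ[ℝ] EuclideanSpace ℝ (α × β) :=
    { toFun := fun l => columnComb (fun i j b => l (i, j, b)) c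
      map_add' := fun x y => by
        ext p; simp [columnComb, add_mul, Finset.sum_add_distrib]
      map_smul' := fun r x => by
        ext p; simp [columnComb, Finset.mul_sum, mul_assoc] }
  refine ⟨LinearMap.range f, ?_, fun l => ⟨fun q => l q.1 q.2.1 q.2.2, rfl⟩⟩
  refine (LinearMap.finrank_range_le f).trans (le_of_eq ?_)
  simp [mul_assoc]

/-- The block estimate: `M i` are the means of the entries in a block, perturbed by the Gaussian
noise `g`, while the columns `c i j y` depend on an independent randomness `y`. -/
theorem stdGaussian_prod_columnComb_near_le [Nonempty κ] {Y : Type*} [TopologicalSpace Y]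
    [SecondCountableTopology Y] [MeasurableSpace Y] [OpensMeasurableSpace Y] (ν : Measure Y)
    [IsProbabilityMeasure ν] (M : κ → EuclideanSpace ℝ (α × β)) (c : Y → κ → η → α → ℝ)
    (hc : ∀ i j a, Continuous fun y => c y i j a)
    (hk : Fintype.card κ ^ 2 ≤ Fintype.card (α × β))
    (hk' : 8 * Fintype.card κ ≤ Fintype.card (α × β))
    (hW : 2 * (Fintype.card κ * Fintype.card η * Fintype.card β + Fintype.card κ)
      ≤ Fintype.card (α × β)) {ε ρ : ℝ} (hε : 0 < ε) (hρ : 0 < ρ) :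
    ((stdGaussian (EuclideanSpace ℝ (κ × α × β))).prod ν)
      {x | ∃ v : EuclideanSpace ℝ κ, ‖v‖ = 1 ∧ ∃ l : κ → η → β → ℝ,
        ‖∑ i, v i • M i + ρ • blockComb v x.1 - columnComb l (c x.2)‖
          < ε * ρ * √(Fintype.card (α × β))}
      ≤ ENNReal.ofReal (2 * (nearConst * ε) ^ ((Fintype.card (α × β) : ℝ) / 4)) := by
  set s := ε * ρ * √(Fintype.card (α × β) : ℝ)
  have hopen : IsOpen {x : EuclideanSpace ℝ (κ × α × β) × Y | ∃ v : EuclideanSpace ℝ κ, ‖v‖ = 1 ∧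
      ∃ l : κ → η → β → ℝ,
        ‖∑ i, v i • M i + ρ • blockComb v x.1 - columnComb l (c x.2)‖ < s} := by
    have : {x : EuclideanSpace ℝ (κ × α × β) × Y | ∃ v : EuclideanSpace ℝ κ, ‖v‖ = 1 ∧
      ∃ l : κ → η → β → ℝ,
        ‖∑ i, v i • M i + ρ • blockComb v x.1 - columnComb l (c x.2)‖ < s}
      = ⋃ (v : EuclideanSpace ℝ κ) (_ : ‖v‖ = 1) (l : κ → η → β → ℝ),
        {x | ‖∑ i, v i • M i + ρ • blockComb v x.1 - columnComb l (c x.2)‖ < s} := by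
      ext x; simp
    rw [this]
    refine isOpen_iUnion fun v => isOpen_iUnion fun _ => isOpen_iUnion fun l => ?_
    have hcont : Continuous fun x : EuclideanSpace ℝ (κ × α × β) × Y => columnComb l (c x.2) := by
      unfold columnComb
      fun_prop
    exact isOpen_lt (by fun_prop) continuous_const
  rw [Measure.prod_apply_symm hopen.measurableSet]
  refine (lintegral_mono (g := fun _ => ENNReal.ofReal
    (2 * (nearConst * ε) ^ ((Fintype.card (α × β) : ℝ) / 4))) fun y => ?_).trans (by simp)
  obtain ⟨W, hWd, hWm⟩ := exists_submodule_columnComb (β := β) (c y)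
  rw [← ofReal_measureReal]
  apply ENNReal.ofReal_le_ofReal
  refine (measureReal_mono ?_).trans
    (stdGaussian_shifted_near_le (W := W) M hk hk' (by omega) hε hρ)
  rintro g ⟨v, hv, l, h⟩
  exact ⟨v, hv, _, hWm l, h.le⟩

end

section
variable {Ω : Type*} [MeasurableSpace Ω] {P : Measure Ω} [IsProbabilityMeasure P] {ρ : ℝ}
  {Δ : Ω → Fin k → Matrix (Fin n) (Fin n) ℝ}

/-- With overwhelming probability, in the block of rows `I` and columns `J` every unit combination of
the perturbed matrices is far from having all its columns in the span of the perturbed columns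
indexed by `H`. The positions `I × J` and `I × H` are off-diagonal and pairwise distinct as
unordered pairs, so the noise in the block is independent of the noise in those columns. -/
theorem IsSymmGaussianNoise.block_near_le (hΔ : IsSymmGaussianNoise P ρ Δ) (hρ : 0 < ρ)
    (hk0 : 0 < k) (A : Fin k → Matrix (Fin n) (Fin n) ℝ) {H I J : Finset (Fin n)}
    (hIJ : Disjoint I J) (hIH : Disjoint I H) (hJH : Disjoint J H)
    (hk : k ^ 2 ≤ I.card * J.card) (hk' : 8 * k ≤ I.card * J.card)
    (hW : 2 * (k * H.card * J.card + k) ≤ I.card * J.card) {ε : ℝ} (hε : 0 < ε) :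
    P {w | ∃ v : EuclideanSpace ℝ (Fin k), ‖v‖ = 1 ∧ ∃ l : Fin k → H → J → ℝ,
      ‖(WithLp.toLp 2 fun p : I × J => ∑ i, v i * (A i p.1 p.2 + Δ w i p.1 p.2)
        - ∑ i, ∑ j, l i j p.2 * (A i p.1 j + Δ w i p.1 j) : EuclideanSpace ℝ (I × J))‖
        < ε * ρ * √(I.card * J.card : ℕ)}
      ≤ ENNReal.ofReal (2 * (nearConst * ε) ^ ((I.card * J.card : ℕ) / 4 : ℝ)) := by
  have : Nonempty (Fin k) := ⟨⟨0, hk0⟩⟩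
  set e : (Fin k × I × J) ⊕ (Fin k × I × H) → Fin k := Sum.elim (fun t => t.1) (fun t => t.1)
  set a : (Fin k × I × J) ⊕ (Fin k × I × H) → Fin n :=
    Sum.elim (fun t => t.2.1) (fun t => t.2.1) with ha
  set b : (Fin k × I × J) ⊕ (Fin k × I × H) → Fin n :=
    Sum.elim (fun t => t.2.2) (fun t => t.2.2) with hb
  have haI (t) : a t ∈ I := by rcases t with t | t <;> exact t.2.1.2
  have hbI (t) : b t ∉ I := by
    rcases t with t | t
    · exact fun h => Finset.disjoint_left.1 hIJ h t.2.2.2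
    · exact fun h => Finset.disjoint_left.1 hIH h t.2.2.2
  have hab (t) : a t ≠ b t := fun h => hbI t (h ▸ haI t)
  have hinj : Function.Injective fun t => (e t, sortedPos (a t) (b t) (hab t)) := by
    intro t t' h
    simp only [Prod.mk.injEq, sortedPos, Subtype.mk.injEq] at h
    obtain ⟨h1, h2, h3⟩ := h
    have h4 : a t = a t' ∧ b t = b t' := by
      have := haI t; have := haI t'; have := hbI t; have := hbI t'
      rcases le_total (a t) (b t) with h | h <;> rcases le_total (a t') (b t') with h' | h' <;>
        simp only [min_eq_left h, min_eq_right h, max_eq_left h, max_eq_right h, min_eq_left h',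
          min_eq_right h', max_eq_left h', max_eq_right h'] at h2 h3 <;> grind
    have hJH' (x : Fin n) : x ∈ J → x ∉ H := fun hx => Finset.disjoint_left.1 hJH hx
    rcases t with ⟨i, x, y⟩ | ⟨i, x, y⟩ <;> rcases t' with ⟨i', x', y'⟩ | ⟨i', x', y'⟩ <;>
      simp only [e, a, b, Sum.elim_inl, Sum.elim_inr] at h1 h4
    · rw [h1, Subtype.ext h4.1, Subtype.ext h4.2]
    · exact absurd (h4.2 ▸ y'.2) (hJH' _ y.2)
    · exact absurd (h4.2 ▸ y.2) (hJH' _ y'.2)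
    · rw [h1, Subtype.ext h4.1, Subtype.ext h4.2]
  have hlaw := hΔ.map_eq_stdGaussian_prod hρ e a b hab hinj
  have hcard : Fintype.card (I × J) = I.card * J.card := by simp
  have hmain := stdGaussian_prod_columnComb_near_le (κ := Fin k) (α := I) (β := J) (η := H)
    (stdGaussian (EuclideanSpace ℝ (Fin k × I × H)))
    (fun i => WithLp.toLp 2 fun p : I × J => A i p.1 p.2)
    (fun y i j x => A i x j + ρ * y (i, x, j)) (fun i j x => by fun_prop)
    (by simpa using hk) (by simpa using hk') (by simpa using hW) hε hρ
  rw [hcard, ← hlaw] at hmain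
  have hmeas : AEMeasurable (fun w =>
      ((WithLp.toLp 2 fun t => Δ w (e (.inl t)) (a (.inl t)) (b (.inl t)) / ρ,
        WithLp.toLp 2 fun t => Δ w (e (.inr t)) (a (.inr t)) (b (.inr t)) / ρ) :
          EuclideanSpace ℝ (Fin k × I × J) × EuclideanSpace ℝ (Fin k × I × H))) P := by
    apply aemeasurable_of_map_neZero
    rw [hlaw]; infer_instance
  refine (measure_mono ?_).trans ((Measure.le_map_apply hmeas _).trans hmain)
  rintro w ⟨v, hv, l, h⟩
  refine ⟨v, hv, l, lt_of_le_of_lt (le_of_eq ?_) h⟩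
  congr 1
  ext p
  have hcancel (x : ℝ) : ρ * (x / ρ) = x := by field_simp
  simp only [columnComb, PiLp.sub_apply, PiLp.add_apply, PiLp.smul_apply, WithLp.ofLp_sum,
    WithLp.ofLp_smul, Finset.sum_apply, Pi.smul_apply, smul_eq_mul, blockComb_apply, e, a, b,
    Sum.elim_inl, Sum.elim_inr, hcancel, Finset.mul_sum, mul_add, Finset.sum_add_distrib]
  congr 2
  exact Finset.sum_congr rfl fun i _ => by field_simp

/-- With overwhelming probability, every unit combination of the perturbed matrices has large entries
at the off-diagonal positions in `H × H`. -/
theorem IsSymmGaussianNoise.sampled_near_le (hΔ : IsSymmGaussianNoise P ρ Δ) (hρ : 0 < ρ)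
    (hk0 : 0 < k) (A : Fin k → Matrix (Fin n) (Fin n) ℝ) {H : Finset (Fin n)}
    (hk : k ^ 2 ≤ Fintype.card (StrictPairs H)) (hk' : 8 * k ≤ Fintype.card (StrictPairs H))
    {ε : ℝ} (hε : 0 < ε) :
    P {w | ∃ v : EuclideanSpace ℝ (Fin k), ‖v‖ = 1 ∧
      ‖(WithLp.toLp 2 fun p : StrictPairs H => ∑ i, v i * (A i p.1.1 p.1.2 + Δ w i p.1.1 p.1.2) :
        EuclideanSpace ℝ (StrictPairs H))‖ < ε * ρ * √(Fintype.card (StrictPairs H))}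
      ≤ ENNReal.ofReal (2 * (nearConst * ε) ^ ((Fintype.card (StrictPairs H) : ℝ) / 4)) := by
  have : Nonempty (Fin k) := ⟨⟨0, hk0⟩⟩
  have hlaw := hΔ.map_eq_stdGaussian hρ (τ := Fin k × StrictPairs H) (fun t => t.1)
    (fun t => t.2.1.1) (fun t => t.2.1.2) (fun t => t.2.2.1.ne) (by
      rintro ⟨i, p⟩ ⟨i', p'⟩ h
      simp only [Prod.mk.injEq, sortedPos, Subtype.mk.injEq, min_eq_left p.2.1.le,
        max_eq_right p.2.1.le, min_eq_left p'.2.1.le, max_eq_right p'.2.1.le] at h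
      rw [h.1, Subtype.ext (Prod.ext h.2.1 h.2.2)])
  have hmain := stdGaussian_shifted_near_le (κ := Fin k) (ι := StrictPairs H) (W := ⊥)
    (fun i => WithLp.toLp 2 fun p : StrictPairs H => A i p.1.1 p.1.2)
    (by simpa using hk) (by simpa using hk') (by simp; omega) hε hρ
  rw [← hlaw] at hmain
  have hmeas : AEMeasurable (fun w => (WithLp.toLp 2 fun t : Fin k × StrictPairs H =>
      Δ w t.1 t.2.1.1 t.2.1.2 / ρ : EuclideanSpace ℝ (Fin k × StrictPairs H))) P := by
    apply aemeasurable_of_map_neZero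
    rw [hlaw]; infer_instance
  have hprob : IsProbabilityMeasure (P.map (fun w => (WithLp.toLp 2 fun t : Fin k × StrictPairs H =>
      Δ w t.1 t.2.1.1 t.2.1.2 / ρ : EuclideanSpace ℝ (Fin k × StrictPairs H)))) :=
    Measure.isProbabilityMeasure_map hmeas
  have hmain' := ENNReal.ofReal_le_ofReal hmain
  rw [ofReal_measureReal] at hmain'
  refine (measure_mono ?_).trans ((Measure.le_map_apply hmeas _).trans hmain')
  rintro w ⟨v, hv, h⟩
  refine ⟨v, hv, 0, Submodule.zero_mem _, le_trans (le_of_eq ?_) h.le⟩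
  congr 1
  ext p
  simp only [PiLp.add_apply, PiLp.smul_apply, WithLp.ofLp_sum,
    WithLp.ofLp_smul, Finset.sum_apply, Pi.smul_apply, smul_eq_mul, blockComb_apply,
    Finset.mul_sum, mul_add, Finset.sum_add_distrib, sub_zero]
  congr 1
  exact Finset.sum_congr rfl fun i _ => by field_simp

end
end

/-! ### The event that the perturbation succeeds -/

noncomputable section
variable {n k : ℕ}

/-- It suffices that every noise matrix is at least `-1/2`: then the diagonals of the covariances
can be increased by `1/2`. -/
lemma perturbationSucceeds_of_le {G : ZeroMeanGMM n k} (hG : G.IsScaled)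
    {D : Fin k → Matrix (Fin n) (Fin n) ℝ} (hs : ∀ i, (D i).IsSymm) (hd : ∀ i a, D i a a = 0)
    (h : ∀ i (v : EuclideanSpace ℝ (Fin n)), ‖v‖ = 1 → -(1 / 2) ≤ v ⬝ᵥ (D i).mulVec v) :
    PerturbationSucceeds G D := by
  have hquad (i) (y : EuclideanSpace ℝ (Fin n)) : -(1 / 2) * ‖y‖ ^ 2 ≤ y ⬝ᵥ (D i).mulVec y := by
    rcases (norm_nonneg y).eq_or_lt with h0 | h0
    · rw [eq_comm, norm_eq_zero] at h0
      subst h0; simp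
    · have h1 := h i (‖y‖⁻¹ • y) (by rw [norm_smul, norm_inv, norm_norm, inv_mul_cancel₀ h0.ne'])
      simp only [WithLp.ofLp_smul, Matrix.mulVec_smul, dotProduct_smul, smul_dotProduct,
        smul_eq_mul] at h1
      have h2 := mul_le_mul_of_nonneg_right h1 (sq_nonneg ‖y‖)
      refine h2.trans (le_of_eq ?_)
      field_simp
  refine ⟨fun i => G.cov i + D i + (1 / 2 : ℝ) • 1, fun i => ⟨?_, ?_, ?_⟩⟩
  · intro a b hab
    simp [Matrix.one_apply_ne hab]
  · have hC := G.cov_posSemidef i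
    refine Matrix.PosSemidef.of_dotProduct_mulVec_nonneg ?_ fun x => ?_
    · have h1 : (D i).IsHermitian := by
        rw [Matrix.IsHermitian, Matrix.conjTranspose_eq_transpose_of_trivial]; exact hs i
      have h2 : ((1 / 2 : ℝ) • (1 : Matrix (Fin n) (Fin n) ℝ)).IsHermitian := by
        rw [Matrix.IsHermitian, Matrix.conjTranspose_eq_transpose_of_trivial]; simp
      exact (hC.1.add h1).add h2
    · have h1 := hC.dotProduct_mulVec_nonneg x
      have h2 := hquad i (WithLp.toLp 2 x)
      rw [EuclideanSpace.real_norm_sq_eq] at h2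
      have h3 : x ⬝ᵥ x = ∑ a, x a ^ 2 := by simp [dotProduct, sq]
      simp only [star_trivial, Matrix.add_mulVec, dotProduct_add, Matrix.smul_mulVec,
        Matrix.one_mulVec, dotProduct_smul, smul_eq_mul] at h1 ⊢
      rw [h3]
      linarith
  · intro a
    have h1 := (hG i).diag_nonneg (i := a)
    simp only [Matrix.sub_apply, Matrix.smul_apply, Matrix.one_apply_eq, smul_eq_mul] at h1
    simp only [Matrix.add_apply, Matrix.smul_apply, Matrix.one_apply_eq, smul_eq_mul, hd]
    linarith

/-- The set of noises for which the perturbation succeeds is closed, because the admissible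
diagonals range over a compact set. -/
lemma isClosed_perturbationSucceeds (G : ZeroMeanGMM n k) :
    IsClosed {D : Fin k → Fin n → Fin n → ℝ |
      PerturbationSucceeds G fun i => Matrix.of (D i)} := by
  set M : (Fin k → Fin n → Set.Icc (0 : ℝ) 1) × (Fin k → Fin n → Fin n → ℝ) → Fin k →
      Matrix (Fin n) (Fin n) ℝ :=
    fun x i => Matrix.of fun a b => if a = b then (x.1 i a : ℝ) else G.cov i a b + x.2 i a b
    with hM
  have hMc (i a b) : Continuous fun x => M x i a b := by
    by_cases h : a = b
    · simp only [hM, Matrix.of_apply, h, if_true]; fun_prop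
    · simp only [hM, Matrix.of_apply, h, if_false]; fun_prop
  have hT : IsClosed {x | ∀ i, (M x i).PosSemidef} := by
    have : {x | ∀ i, (M x i).PosSemidef} = (⋂ (i) (a) (b), {x | M x i b a = M x i a b}) ∩
        ⋂ (i) (y : Fin n → ℝ), {x | 0 ≤ ∑ a, y a * ∑ b, M x i a b * y b} := by
      ext x
      simp only [Set.mem_ofPred_eq, Set.mem_inter_iff, Set.mem_iInter]
      constructor
      · intro h
        refine ⟨fun i a b => by simpa using (h i).1.apply a b, fun i y => ?_⟩
        simpa [dotProduct, Matrix.mulVec] using (h i).dotProduct_mulVec_nonneg y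
      · rintro ⟨h1, h2⟩ i
        refine Matrix.PosSemidef.of_dotProduct_mulVec_nonneg ?_ fun y => ?_
        · ext a b
          simpa using h1 i a b
        · simpa [dotProduct, Matrix.mulVec] using h2 i y
    rw [this]
    refine IsClosed.inter ?_ ?_
    · exact isClosed_iInter fun i => isClosed_iInter fun a => isClosed_iInter fun b =>
        isClosed_eq (hMc _ _ _) (hMc _ _ _)
    · exact isClosed_iInter fun i => isClosed_iInter fun y => isClosed_le continuous_const
        (continuous_finsetSum _ fun a _ => continuous_const.mul
          (continuous_finsetSum _ fun b _ => (hMc _ _ _).mul continuous_const))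
  have himg : {D : Fin k → Fin n → Fin n → ℝ | PerturbationSucceeds G fun i => Matrix.of (D i)}
      = Prod.snd '' {x | ∀ i, (M x i).PosSemidef} := by
    ext D
    constructor
    · rintro ⟨C, hC⟩
      refine ⟨(fun i a => ⟨C i a a, (hC i).2.1.diag_nonneg, (hC i).2.2 a⟩, D), fun i => ?_, rfl⟩
      have : M (fun i a => ⟨C i a a, (hC i).2.1.diag_nonneg, (hC i).2.2 a⟩, D) i = C i := by
        ext a b
        by_cases h : a = b
        · simp [hM, h]
        · simp [hM, h, (hC i).1 a b h]
      rw [this]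
      exact (hC i).2.1
    · rintro ⟨x, hx, rfl⟩
      refine ⟨M x, fun i => ⟨fun a b hab => by simp [hM, hab], hx i, fun a => ?_⟩⟩
      simpa [hM] using (x.1 i a).2.2
  rw [himg]
  exact isClosedMap_snd_of_compactSpace _ hT

section
variable {Ω : Type*} [MeasurableSpace Ω] {P : Measure Ω} {ρ : ℝ}
  {Δ : Ω → Fin k → Matrix (Fin n) (Fin n) ℝ}

lemma IsSymmGaussianNoise.measurableSet_succeeds (hΔ : IsSymmGaussianNoise P ρ Δ)
    (G : ZeroMeanGMM n k) : MeasurableSet {w | PerturbationSucceeds G (Δ w)} := by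
  have hm : Measurable fun w i a b => Δ w i a b :=
    measurable_pi_lambda _ fun i => measurable_pi_lambda _ fun a => measurable_pi_lambda _ fun b =>
      hΔ.measurable i a b
  exact hm (isClosed_perturbationSucceeds G).measurableSet

end

lemma sum_sum_eq_two_mul_sum_lt {f : Fin n → Fin n → ℝ} (hs : ∀ a b, f a b = f b a)
    (hd : ∀ a, f a a = 0) :
    ∑ a, ∑ b, f a b = 2 * ∑ q : {q : Fin n × Fin n // q.1 < q.2}, f q.1.1 q.1.2 := by
  rw [← Fintype.sum_prod_type', ← Finset.sum_subtype (Finset.univ.filter fun q : Fin n × Fin n =>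
    q.1 < q.2) (by simp) (fun q => f q.1 q.2), two_mul]
  rw [← Finset.sum_filter_add_sum_filter_not Finset.univ (fun q : Fin n × Fin n => q.1 < q.2)]
  congr 1
  rw [← Finset.sum_filter_add_sum_filter_not (Finset.univ.filter fun q : Fin n × Fin n =>
    ¬ q.1 < q.2) (fun q : Fin n × Fin n => q.1 = q.2)]
  have h1 : ∑ q ∈ (Finset.univ.filter fun q : Fin n × Fin n => ¬ q.1 < q.2).filter
      (fun q => q.1 = q.2), f q.1 q.2 = 0 := by
    refine Finset.sum_eq_zero fun q hq => ?_
    rw [(Finset.mem_filter.1 hq).2, hd]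
  rw [h1, zero_add]
  refine Finset.sum_bij' (fun q _ => q.swap) (fun q _ => q.swap) ?_ ?_ ?_ ?_ ?_
  · intro q hq
    simp only [Finset.mem_filter, Finset.mem_univ, true_and, Prod.fst_swap, Prod.snd_swap] at hq ⊢
    omega
  · intro q hq
    simp only [Finset.mem_filter, Finset.mem_univ, true_and, Prod.fst_swap, Prod.snd_swap] at hq ⊢
    omega
  · simp
  · simp
  · intro q _; exact hs _ _

lemma abs_dotProduct_mulVec_le (D : Matrix (Fin n) (Fin n) ℝ) (x y : EuclideanSpace ℝ (Fin n)) :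
    |x ⬝ᵥ D.mulVec y| ≤ √(∑ a, ∑ b, D a b ^ 2) * ‖x‖ * ‖y‖ := by
  apply abs_le_of_sq_le_sq _ (by positivity)
  rw [mul_pow, mul_pow, Real.sq_sqrt (by positivity), EuclideanSpace.real_norm_sq_eq,
    EuclideanSpace.real_norm_sq_eq]
  calc (x ⬝ᵥ D.mulVec y) ^ 2 ≤ (∑ a, x a ^ 2) * ∑ a, (D.mulVec y a) ^ 2 :=
        Finset.sum_mul_sq_le_sq_mul_sq Finset.univ x (D.mulVec y)
    _ ≤ (∑ a, x a ^ 2) * ∑ a, (∑ b, D a b ^ 2) * ∑ b, y b ^ 2 := by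
        refine mul_le_mul_of_nonneg_left (Finset.sum_le_sum fun a _ => ?_) (by positivity)
        exact Finset.sum_mul_sq_le_sq_mul_sq Finset.univ (D a) y
    _ = _ := by rw [← Finset.sum_mul]; ring

/-- The Chernoff bound for one-dimensional marginals. -/
lemma stdGaussian_inner_le {ι : Type*} [Fintype ι] (t : EuclideanSpace ℝ ι) {s σ : ℝ} (hs : 0 ≤ s)
    (hσ : 0 < σ) (ht : ‖t‖ ^ 2 ≤ σ) :
    (stdGaussian (EuclideanSpace ℝ ι)).real {g | inner ℝ t g ≤ -s}
      ≤ Real.exp (-(s ^ 2 / (2 * σ))) := by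
  classical
  have hlaw := map_inner_multivariateGaussian (C := (1 : Matrix ι ι ℝ)) Matrix.PosSemidef.one t
  rw [multivariateGaussian_zero_one] at hlaw
  have h2 : t ⬝ᵥ (1 : Matrix ι ι ℝ).mulVec t = ‖t‖ ^ 2 := by
    rw [EuclideanSpace.real_norm_sq_eq]; simp [dotProduct, sq]
  rw [h2] at hlaw
  have hmgf := mgf_gaussianReal hlaw (-(s / σ))
  have hint : Integrable (fun g => Real.exp (-(s / σ) * inner ℝ t g))
      (stdGaussian (EuclideanSpace ℝ ι)) := by
    have := integrable_exp_mul_gaussianReal (μ := 0) (v := Real.toNNReal (‖t‖ ^ 2)) (-(s / σ))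
    rw [← hlaw, integrable_map_measure (by fun_prop) (by fun_prop)] at this
    exact this
  have h := measure_le_le_exp_mul_mgf (μ := stdGaussian (EuclideanSpace ℝ ι))
    (X := fun g => inner ℝ t g) (-s) (neg_nonpos.2 (div_nonneg hs hσ.le)) hint
  refine h.trans ?_
  rw [hmgf, Real.coe_toNNReal _ (sq_nonneg _), ← Real.exp_add, Real.exp_le_exp]
  have h3 : ‖t‖ ^ 2 * (-(s / σ)) ^ 2 / 2 ≤ σ * (-(s / σ)) ^ 2 / 2 := by gcongr
  have h4 : σ * (-(s / σ)) ^ 2 / 2 = s ^ 2 / (2 * σ) := by field_simp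
  have h5 : -(-(s / σ)) * -s = -(2 * (s ^ 2 / (2 * σ))) := by field_simp
  linarith

end

/-! ### Probability of success -/

noncomputable section
variable {n k : ℕ}

/-- The vector representing the quadratic form `uᵀ D⁽ⁱ⁾ u` as a linear form in the entries of
`D⁽ⁱ⁾` above the diagonal. -/
def quadDual (i : Fin k) (u : EuclideanSpace ℝ (Fin n)) :
    EuclideanSpace ℝ (Fin k × {q : Fin n × Fin n // q.1 < q.2}) :=
  WithLp.toLp 2 fun p => if p.1 = i then 2 * (u p.2.1.1 * u p.2.1.2) else 0

lemma norm_sq_quadDual_le (i : Fin k) (u : EuclideanSpace ℝ (Fin n)) :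
    ‖quadDual i u‖ ^ 2 ≤ 2 * (‖u‖ ^ 2) ^ 2 := by
  have h1 : ‖quadDual i u‖ ^ 2
      = 2 * ∑ a, ∑ b, if a = b then 0 else u a ^ 2 * u b ^ 2 := by
    rw [sum_sum_eq_two_mul_sum_lt (fun a b => by simp only [eq_comm (a := a), mul_comm])
      (fun a => by simp), EuclideanSpace.real_norm_sq_eq, Fintype.sum_prod_type,
      Finset.sum_eq_single i (fun j _ hj => by simp [quadDual, hj]) (by simp), Finset.mul_sum,
      Finset.mul_sum]
    refine Finset.sum_congr rfl fun q _ => ?_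
    simp only [quadDual, if_true, q.2.ne, if_false]
    ring
  rw [h1, EuclideanSpace.real_norm_sq_eq, sq, Finset.sum_mul_sum]
  gcongr with a _ b _
  split_ifs
  · positivity
  · exact le_rfl

section
variable {D : Fin k → Matrix (Fin n) (Fin n) ℝ} {ρ : ℝ}
    {g : EuclideanSpace ℝ (Fin k × {q : Fin n × Fin n // q.1 < q.2})}

lemma dotProduct_mulVec_eq_inner_quadDual (hs : ∀ i, (D i).IsSymm) (hd : ∀ i a, D i a a = 0)
    (hg : ∀ p, D p.1 p.2.1.1 p.2.1.2 = ρ * g p) (i : Fin k) (u : EuclideanSpace ℝ (Fin n)) :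
    u ⬝ᵥ (D i).mulVec u = ρ * inner ℝ (quadDual i u) g := by
  have h1 : u ⬝ᵥ (D i).mulVec u = ∑ a, ∑ b, u a * (D i a b * u b) := by
    simp [dotProduct, Matrix.mulVec, Finset.mul_sum]
  rw [h1, sum_sum_eq_two_mul_sum_lt (fun a b => by rw [(hs i).apply b a]; ring)
    (fun a => by simp [hd]), PiLp.inner_apply, Fintype.sum_prod_type,
    Finset.sum_eq_single i (fun j _ hj => by simp [quadDual, hj]) (by simp), Finset.mul_sum,
    Finset.mul_sum]
  refine Finset.sum_congr rfl fun q _ => ?_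
  rw [hg (i, q)]
  simp only [quadDual, if_true, RCLike.inner_apply, conj_trivial]
  ring

lemma sum_sq_le_of_noise (hs : ∀ i, (D i).IsSymm) (hd : ∀ i a, D i a a = 0)
    (hg : ∀ p, D p.1 p.2.1.1 p.2.1.2 = ρ * g p) (i : Fin k) :
    ∑ a, ∑ b, D i a b ^ 2 ≤ 2 * ρ ^ 2 * ‖g‖ ^ 2 := by
  rw [sum_sum_eq_two_mul_sum_lt (fun a b => by rw [(hs i).apply b a]) (fun a => by simp [hd]),
    EuclideanSpace.real_norm_sq_eq, Fintype.sum_prod_type, mul_assoc,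
    Finset.mul_sum _ _ (ρ ^ 2)]
  refine mul_le_mul_of_nonneg_left ?_ (by norm_num)
  refine le_trans (le_of_eq ?_) (Finset.single_le_sum (f := fun i => ρ ^ 2 *
    ∑ q : {q : Fin n × Fin n // q.1 < q.2}, g (i, q) ^ 2) (fun j _ =>
      mul_nonneg (sq_nonneg _) (Finset.sum_nonneg fun _ _ => sq_nonneg _)) (Finset.mem_univ i))
  rw [Finset.mul_sum]
  refine Finset.sum_congr rfl fun q _ => ?_
  rw [hg (i, q), mul_pow]

/-- If some noise matrix has a quadratic form below `-1/2` on the unit sphere, then it has a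
quadratic form below `-1/4` on the grid. -/
lemma exists_grid_quadDual_le (hn : 0 < n) (hkn : k ≤ n) (hρ : 0 < ρ) (hρn : ρ < 1 / n)
    (hs : ∀ i, (D i).IsSymm) (hd : ∀ i a, D i a a = 0)
    (hg : ∀ p, D p.1 p.2.1.1 p.2.1.2 = ρ * g p) (hgn : ‖g‖ ^ 2 ≤ 100 * (k * n ^ 2))
    {i : Fin k} {v : EuclideanSpace ℝ (Fin n)} (hv : ‖v‖ = 1)
    (h : v ⬝ᵥ (D i).mulVec v < -(1 / 2)) :
    ∃ z ∈ gridIndex (Fin n) (200 * n), ‖(gridPoint (200 * n) z : EuclideanSpace ℝ (Fin n))‖ ≤ 2 ∧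
      inner ℝ (quadDual i (gridPoint (200 * n) z)) g ≤ -(n / 4 : ℝ) := by
  have hn' : (1 : ℝ) ≤ n := by exact_mod_cast hn
  have hkn' : (k : ℝ) ≤ n := by exact_mod_cast hkn
  obtain ⟨z, hz, hvz⟩ := exists_gridPoint_near (K := 200 * n) (by omega) hv.le
  refine ⟨z, hz, ?_, ?_⟩
  all_goals
    set u : EuclideanSpace ℝ (Fin n) := gridPoint (200 * n) z
    rw [Fintype.card_fin] at hvz
    push_cast at hvz
    have hsq : √(n : ℝ) ≤ n := Real.sqrt_le_iff.2 ⟨by linarith, by nlinarith⟩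
    have hle1 : √(n : ℝ) / (200 * n) ≤ 1 / 200 := by
      rw [div_le_iff₀ (by positivity)]; linarith
    have hu : ‖u‖ ≤ 2 := by
      have := norm_sub_norm_le u v
      rw [norm_sub_rev] at this
      linarith
  · exact hu
  · have hF : √(∑ a, ∑ b, D i a b ^ 2) ≤ 15 * √n := by
      rw [Real.sqrt_le_left (by positivity), mul_pow, Real.sq_sqrt (by positivity)]
      refine (sum_sq_le_of_noise hs hd hg i).trans ?_
      have h1 : ρ ^ 2 ≤ (1 / n) ^ 2 := pow_le_pow_left₀ hρ.le hρn.le 2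
      calc 2 * ρ ^ 2 * ‖g‖ ^ 2 ≤ 2 * (1 / (n : ℝ)) ^ 2 * (100 * (n * (n : ℝ) ^ 2)) := by
            have : (100 * (k * n ^ 2) : ℝ) ≤ 100 * (n * n ^ 2) := by gcongr
            gcongr
            exact hgn.trans this
        _ = 200 * (n : ℝ) := by field_simp; norm_num
        _ ≤ 15 ^ 2 * (n : ℝ) := by nlinarith
    have hB1 := abs_dotProduct_mulVec_le (D i) (v - u) v
    have hB2 := abs_dotProduct_mulVec_le (D i) u (v - u)
    have hsplit : v ⬝ᵥ (D i).mulVec v - u ⬝ᵥ (D i).mulVec u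
        = (v - u : EuclideanSpace ℝ (Fin n)) ⬝ᵥ (D i).mulVec v
          + u ⬝ᵥ (D i).mulVec (v - u : EuclideanSpace ℝ (Fin n)) := by
      simp only [WithLp.ofLp_sub, Matrix.mulVec_sub, dotProduct_sub, sub_dotProduct]
      ring
    have hprod : √(∑ a, ∑ b, D i a b ^ 2) * ‖v - u‖ ≤ 15 / 200 := by
      refine (mul_le_mul hF hvz (norm_nonneg _) (by positivity)).trans (le_of_eq ?_)
      have : √(n : ℝ) * √n = n := Real.mul_self_sqrt (by linarith)
      field_simp
      rw [sq, this]
    have hp0 : 0 ≤ √(∑ a, ∑ b, D i a b ^ 2) * ‖v - u‖ := by positivity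
    have h1 : √(∑ a, ∑ b, D i a b ^ 2) * ‖v - u‖ * ‖v‖ ≤ 15 / 200 := by rw [hv]; linarith
    have h2 : √(∑ a, ∑ b, D i a b ^ 2) * ‖u‖ * ‖v - u‖ ≤ 15 / 200 * 2 := by
      calc _ = √(∑ a, ∑ b, D i a b ^ 2) * ‖v - u‖ * ‖u‖ := by ring
        _ ≤ _ := mul_le_mul hprod hu (norm_nonneg _) (by norm_num)
    have h3 := (abs_le.1 (hB1.trans h1)).1
    have h4 := (abs_le.1 (hB2.trans h2)).1
    have h5 : ρ * inner ℝ (quadDual i u) g ≤ -(1 / 4) := by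
      rw [← dotProduct_mulVec_eq_inner_quadDual hs hd hg]
      linarith
    by_contra hc
    push Not at hc
    have h6 : ρ * n < 1 := by rwa [lt_div_iff₀ (by linarith)] at hρn
    nlinarith
end

/-- The size of the grid and the number of components are beaten by the Gaussian tail at `n / 4`. -/
lemma grid_count_le {x : ℝ} (hx : 2 * 10 ^ 10 ≤ x) {n : ℕ} (hn : x = n) :
    x * (401 * x) ^ n * Real.exp (-((x / 4) ^ 2 / (2 * 32))) ≤ 1 / 4 := by
  have h0 : 0 ≤ x / 4096 := by linarith
  have h1 : 401 * x ≤ Real.exp (x / 4096) := by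
    have := Real.quadratic_le_exp_of_nonneg h0
    nlinarith
  have h2 : x ≤ Real.exp (x / 4096) := by linarith
  have h3 : x * (401 * x) ^ n ≤ Real.exp ((n + 1) * (x / 4096)) := by
    have : (401 * x) ^ n ≤ Real.exp (n * (x / 4096)) := by
      rw [Real.exp_nat_mul]
      exact pow_le_pow_left₀ (by linarith) h1 n
    calc x * (401 * x) ^ n ≤ Real.exp (x / 4096) * Real.exp (n * (x / 4096)) := by
          gcongr
      _ = _ := by rw [← Real.exp_add]; ring_nf
  calc x * (401 * x) ^ n * Real.exp (-((x / 4) ^ 2 / (2 * 32)))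
      ≤ Real.exp ((n + 1) * (x / 4096)) * Real.exp (-((x / 4) ^ 2 / (2 * 32))) := by gcongr
    _ = Real.exp ((n + 1) * (x / 4096) + -((x / 4) ^ 2 / (2 * 32))) := by rw [Real.exp_add]
    _ ≤ Real.exp (-3) := by
        rw [Real.exp_le_exp, ← hn]
        nlinarith
    _ ≤ 1 / 4 := by
        rw [Real.exp_neg, inv_le_comm₀ (Real.exp_pos _) (by norm_num)]
        have := Real.add_one_le_exp (3 : ℝ)
        norm_num at this ⊢
        linarith

section
variable {Ω : Type*} [MeasurableSpace Ω] {P : Measure Ω} [IsProbabilityMeasure P] {ρ : ℝ}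
  {Δ : Ω → Fin k → Matrix (Fin n) (Fin n) ℝ}

/-- The perturbation succeeds with probability at least `1/2`, since with high probability no noise
matrix has an eigenvalue below `-1/2`. -/
theorem IsSymmGaussianNoise.half_le_succeeds (hΔ : IsSymmGaussianNoise P ρ Δ) (hρ : 0 < ρ)
    (hρn : ρ < 1 / n) (hk0 : 0 < k) (hkn : k ≤ n) (hn : 2 * 10 ^ 10 ≤ (n : ℝ))
    {G : ZeroMeanGMM n k} (hG : G.IsScaled) :
    1 / 2 ≤ P.real {w | PerturbationSucceeds G (Δ w)} := by
  have hn2 : 2 ≤ n := by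
    have : (2 : ℝ) ≤ n := by linarith
    exact_mod_cast this
  have hlaw := hΔ.map_eq_stdGaussian hρ (τ := Fin k × {q : Fin n × Fin n // q.1 < q.2})
    (fun t => t.1) (fun t => t.2.1.1) (fun t => t.2.1.2) (fun t => t.2.2.ne) (by
      rintro ⟨i, p⟩ ⟨i', p'⟩ h
      simp only [Prod.mk.injEq, sortedPos, Subtype.mk.injEq, min_eq_left p.2.le,
        max_eq_right p.2.le, min_eq_left p'.2.le, max_eq_right p'.2.le] at h
      rw [h.1, Subtype.ext (Prod.ext h.2.1 h.2.2)])
  set E := EuclideanSpace ℝ (Fin k × {q : Fin n × Fin n // q.1 < q.2})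
  set g : Ω → E := fun w => WithLp.toLp 2 fun t => Δ w t.1 t.2.1.1 t.2.1.2 / ρ with hgdef
  have hmeas : AEMeasurable g P := by
    apply aemeasurable_of_map_neZero
    rw [hlaw]; infer_instance
  have hcardq : Fintype.card {q : Fin n × Fin n // q.1 < q.2} ≤ n ^ 2 := by
    refine (Fintype.card_subtype_le _).trans (le_of_eq ?_)
    simp [sq]
  have hdim : Module.finrank ℝ E = k * Fintype.card {q : Fin n × Fin n // q.1 < q.2} := by
    simp [E]
  have hdim1 : 1 ≤ Module.finrank ℝ E := by
    rw [hdim]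
    have : Nonempty {q : Fin n × Fin n // q.1 < q.2} :=
      ⟨⟨(⟨0, by omega⟩, ⟨1, by omega⟩), by simp [Fin.lt_def]⟩⟩
    exact Nat.mul_pos hk0 Fintype.card_pos
  set T : Finset (Fin k × (Fin n → ℤ)) := Finset.univ ×ˢ gridIndex (Fin n) (200 * n)
  set B1 : Set E := {x | (Module.finrank ℝ E : ℝ) / (1 / 10) ^ 2 ≤ ‖x‖ ^ 2}
  set B2 : Fin k × (Fin n → ℤ) → Set E := fun p =>
    {x | ‖(gridPoint (200 * n) p.2 : EuclideanSpace ℝ (Fin n))‖ ≤ 2 ∧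
      inner ℝ (quadDual p.1 (gridPoint (200 * n) p.2)) x ≤ -(n / 4 : ℝ)} with hB2
  have hsub : {w | PerturbationSucceeds G (Δ w)}ᶜ ⊆ g ⁻¹' (B1 ∪ ⋃ p ∈ T, B2 p) := by
    intro w hw
    by_contra hnot
    apply hw
    refine perturbationSucceeds_of_le hG (hΔ.symm w) (hΔ.diag_zero w) fun i v hv => ?_
    by_contra hc
    push Not at hc
    apply hnot
    by_cases hgB : g w ∈ B1
    · exact Or.inl hgB
    · right
      have hgn : ‖g w‖ ^ 2 ≤ 100 * (k * n ^ 2) := by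
        have h1 : ‖g w‖ ^ 2 < (Module.finrank ℝ E : ℝ) / (1 / 10) ^ 2 := not_le.1 hgB
        have h2 : (Module.finrank ℝ E : ℝ) ≤ k * n ^ 2 := by
          rw [hdim]; exact_mod_cast Nat.mul_le_mul_left k hcardq
        norm_num at h1
        linarith
      obtain ⟨z, hz, h1, h2⟩ := exists_grid_quadDual_le (by omega) hkn hρ hρn (hΔ.symm w)
        (hΔ.diag_zero w) (g := g w) (fun p => by simp only [hgdef]; field_simp) hgn hv hc
      exact Set.mem_biUnion (x := (i, z)) (Finset.mem_product.2 ⟨Finset.mem_univ _, hz⟩) ⟨h1, h2⟩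
  have hP : P.real {w | PerturbationSucceeds G (Δ w)}ᶜ
      ≤ (stdGaussian E).real (B1 ∪ ⋃ p ∈ T, B2 p) := by
    refine (measureReal_mono hsub).trans ?_
    rw [← hlaw]
    have : IsProbabilityMeasure (P.map g) := Measure.isProbabilityMeasure_map hmeas
    exact ENNReal.toReal_mono (measure_ne_top _ _) (Measure.le_map_apply hmeas _)
  have hb1 : (stdGaussian E).real B1 ≤ 1 / 4 := by
    refine (stdGaussian_norm_tail (by norm_num)).trans ?_
    refine (pow_le_pow_of_le_one (by norm_num) (by norm_num) hdim1).trans ?_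
    norm_num
  have hb2 (p : Fin k × (Fin n → ℤ)) :
      (stdGaussian E).real (B2 p) ≤ Real.exp (-(((n : ℝ) / 4) ^ 2 / (2 * 32))) := by
    by_cases hp : ‖(gridPoint (200 * n) p.2 : EuclideanSpace ℝ (Fin n))‖ ≤ 2
    · refine (measureReal_mono (fun x hx => hx.2)).trans
        (stdGaussian_inner_le _ (by positivity) (by norm_num) ?_)
      refine (norm_sq_quadDual_le _ _).trans ?_
      have h4 := pow_le_pow_left₀ (norm_nonneg _) hp 2
      have h5 := pow_le_pow_left₀ (sq_nonneg _) h4 2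
      linarith
    · simp only [hB2, hp, false_and, Set.ofPred_false, measureReal_empty]
      positivity
  have hb3 : (stdGaussian E).real (⋃ p ∈ T, B2 p) ≤ 1 / 4 := by
    refine (measureReal_biUnion_finset_le _ _).trans
      ((Finset.sum_le_sum fun p _ => hb2 p).trans ?_)
    rw [Finset.sum_const, nsmul_eq_mul, Finset.card_product, Finset.card_univ, Fintype.card_fin,
      card_gridIndex, Fintype.card_fin]
    refine le_trans ?_ (grid_count_le hn rfl)
    push_cast
    have : (k : ℝ) ≤ n := by exact_mod_cast hkn
    have h1 : (2 * (200 * n) + 1 : ℝ) ≤ 401 * n := by linarith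
    gcongr
  have hcompl := probReal_compl_eq_one_sub (μ := P) (hΔ.measurableSet_succeeds G)
  have := measureReal_union_le (μ := stdGaussian E) B1 (⋃ p ∈ T, B2 p)
  linarith

end
end

/-! ### Choice of the blocks and conclusion -/

noncomputable section

lemma card_strictPairs_ge {n : ℕ} (H : Finset (Fin n)) :
    H.card * H.card - H.card ≤ 2 * Fintype.card (StrictPairs H) := by
  classical
  rw [← Finset.offDiag_card, mul_comm, ← Fintype.card_bool, ← Fintype.card_prod, ← Finset.card_univ]
  refine le_trans (Finset.card_le_card (t := Finset.univ.image fun x : StrictPairs H × Bool =>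
    if x.2 then x.1.1 else x.1.1.swap) fun p hp => ?_) Finset.card_image_le
  obtain ⟨h1, h2, h3⟩ := Finset.mem_offDiag.1 hp
  rw [Finset.mem_image]
  rcases h3.lt_or_gt with h | h
  · exact ⟨(⟨p, h, h1, h2⟩, true), Finset.mem_univ _, rfl⟩
  · exact ⟨(⟨p.swap, h, h2, h1⟩, false), Finset.mem_univ _, rfl⟩

/-- The sizes of the blocks: `m = ⌊n/4⌋` rows and columns outside `H`, with `|H| = ⌊√n⌋`, are large
compared with the number `k` of components. -/
lemma block_sizes {n k h N : ℕ} (hk : 0 < k) (hn : 10 ^ 12 * k ^ 2 ≤ n) (hh : h = Nat.sqrt n)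
    (hN : h * h - h ≤ 2 * N) :
    n / 4 + n / 4 + h ≤ n ∧ k ≤ n ∧ n ≤ 4 * N ∧ k ^ 2 ≤ N ∧ 8 * k ≤ N ∧
      n ≤ 5 * (n / 4) ∧ n ≤ (n / 4) * (n / 4) ∧
      k ^ 2 ≤ (n / 4) * (n / 4) ∧ 8 * k ≤ (n / 4) * (n / 4) ∧
      2 * (k * h * (n / 4) + k) ≤ (n / 4) * (n / 4) := by
  have h1 : h * h ≤ n := hh ▸ Nat.sqrt_le n
  have h2 : n < (h + 1) * (h + 1) := hh ▸ Nat.lt_succ_sqrt n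
  have hkk : k ≤ k ^ 2 := Nat.le_self_pow (by norm_num) k
  have hn12 : 10 ^ 12 ≤ n := by nlinarith
  have hh4 : 100 ≤ h := by
    by_contra hc
    have : h + 1 ≤ 100 := by omega
    have := Nat.mul_le_mul this this
    omega
  have hhn : 100 * h ≤ n := (Nat.mul_le_mul_right h hh4).trans h1
  have hnN : n ≤ 4 * N := by
    have h3 : 100 * h ≤ h * h := Nat.mul_le_mul_right h hh4
    have h4 : (h + 1) * (h + 1) = h * h + 2 * h + 1 := by ring
    omega
  set m := n / 4 with hm
  have hm5 : n ≤ 5 * m := by omega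
  have hmm : n ≤ m * m := by
    have : 5 * m ≤ m * m := Nat.mul_le_mul_right m (by omega)
    omega
  have hkh : 4 * (k * h) ≤ m := by
    -- `(k h)² ≤ k² n ≤ n² / 10¹²`
    have h3 : (10 ^ 6 * (k * h)) ^ 2 ≤ n ^ 2 := by
      calc (10 ^ 6 * (k * h)) ^ 2 = (10 ^ 12 * k ^ 2) * (h * h) := by ring
        _ ≤ n * n := Nat.mul_le_mul hn h1
        _ = n ^ 2 := by ring
    have h4 := (Nat.pow_le_pow_iff_left (by norm_num)).1 h3
    omega
  refine ⟨by omega, by omega, hnN, by omega, by omega, hm5, hmm, by omega, by omega, ?_⟩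
  have hk1 : k ≤ k * h * m := by
    rw [mul_assoc]
    exact Nat.le_mul_of_pos_right k (Nat.mul_pos (by omega) (by omega))
  have := Nat.mul_le_mul_right m hkh
  nlinarith

/-- The lower bounds `ε ρ √N` for the block, which has `N = ⌊n/4⌋²` entries, and for the sampled
entries, of which there are `N ≥ n/4`, multiply to the order `(ερ)² n^{3/2}`. -/
lemma target_le_mul_bounds {n N : ℕ} {ε ρ ω : ℝ} (hω : 0 < ω)
    (hN : n ≤ 4 * N) (hm : n ≤ 5 * (n / 4)) :
    1 / 10 * ω * (ε * ρ) ^ 2 * (n : ℝ) ^ (3 / 2 : ℝ)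
      ≤ (ε * ρ * √((n / 4 * (n / 4) : ℕ) : ℝ)) * ω * (ε * ρ * √(N : ℝ)) := by
  have h1 : √((n / 4 * (n / 4) : ℕ) : ℝ) = ((n / 4 : ℕ) : ℝ) := by
    rw [Nat.cast_mul, Real.sqrt_mul_self (Nat.cast_nonneg _)]
  have h2 : (n : ℝ) / 5 ≤ ((n / 4 : ℕ) : ℝ) := by
    rw [div_le_iff₀ (by norm_num), mul_comm]
    exact_mod_cast hm
  have h3 : √(n : ℝ) / 2 ≤ √(N : ℝ) := by
    have : (n : ℝ) ≤ 4 * N := by exact_mod_cast hN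
    have h4 := Real.sqrt_le_sqrt this
    rw [Real.sqrt_mul (by norm_num), show √(4 : ℝ) = 2 by
      rw [show (4 : ℝ) = 2 ^ 2 by norm_num]; exact Real.sqrt_sq (by norm_num)] at h4
    linarith
  have h4 : (n : ℝ) ^ (3 / 2 : ℝ) = n * √n := by
    rw [show (3 / 2 : ℝ) = 1 + 1 / 2 by norm_num, Real.rpow_add_of_nonneg (Nat.cast_nonneg _)
      (by norm_num) (by norm_num), Real.rpow_one, ← Real.sqrt_eq_rpow]
  rw [h1, h4]
  calc 1 / 10 * ω * (ε * ρ) ^ 2 * (n * √n) = ω * (ε * ρ) ^ 2 * ((n : ℝ) / 5 * (√n / 2)) := by ring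
    _ ≤ ω * (ε * ρ) ^ 2 * (((n / 4 : ℕ) : ℝ) * √N) := by gcongr
    _ = _ := by ring

/-- The two failure probabilities, doubled by conditioning on an event of probability at least
`1/2`; the constant factors are absorbed into the base of the exponential. -/
lemma failure_bound_le {n NA NB : ℕ} {ε : ℝ} (hε : 0 < ε) (hC : 4 * nearConst * ε ≤ 1)
    (hn : 16 ≤ n) (hA : n ≤ NA) (hB : n ≤ 4 * NB) :
    2 * (2 * (nearConst * ε) ^ ((NA : ℝ) / 4) + 2 * (nearConst * ε) ^ ((NB : ℝ) / 4))
      ≤ 2 * (4 * nearConst * ε) ^ (1 / 16 * (n : ℝ)) := by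
  have hx : 0 < nearConst * ε := by rw [nearConst]; positivity
  have hx1 : nearConst * ε ≤ 1 := by linarith
  have hA' : (n : ℝ) ≤ NA := by exact_mod_cast hA
  have hB' : (n : ℝ) ≤ 4 * NB := by exact_mod_cast hB
  have hn' : (16 : ℝ) ≤ n := by exact_mod_cast hn
  have h1 : (nearConst * ε) ^ ((NA : ℝ) / 4) ≤ (nearConst * ε) ^ (1 / 16 * (n : ℝ)) :=
    Real.rpow_le_rpow_of_exponent_ge hx hx1 (by linarith)
  have h2 : (nearConst * ε) ^ ((NB : ℝ) / 4) ≤ (nearConst * ε) ^ (1 / 16 * (n : ℝ)) :=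
    Real.rpow_le_rpow_of_exponent_ge hx hx1 (by linarith)
  have h3 : (4 * nearConst * ε) ^ (1 / 16 * (n : ℝ))
      = 4 ^ (1 / 16 * (n : ℝ)) * (nearConst * ε) ^ (1 / 16 * (n : ℝ)) := by
    rw [mul_assoc, Real.mul_rpow (by norm_num) hx.le]
  have h4 : (4 : ℝ) ≤ 4 ^ (1 / 16 * (n : ℝ)) := by
    calc (4 : ℝ) = 4 ^ (1 : ℝ) := by rw [Real.rpow_one]
      _ ≤ _ := Real.rpow_le_rpow_of_exponent_le (by norm_num) (by linarith)
  rw [h3]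
  have h5 : 0 ≤ (nearConst * ε) ^ (1 / 16 * (n : ℝ)) := by positivity
  nlinarith [mul_le_mul_of_nonneg_right h4 h5]

end

theorem mainTheorem8 :
    ∃ C₀ C₁ C₂ C₃ : ℝ, 0 < C₀ ∧ 0 < C₁ ∧ 0 < C₂ ∧ 0 < C₃ ∧
      ∀ (n k : ℕ), C₀ * (k : ℝ) ^ 2 ≤ (n : ℝ) →
      ∀ (G : ZeroMeanGMM n k), G.IsScaled →
      ∀ (ω₀ : ℝ), 0 < ω₀ → (∀ i, ω₀ ≤ G.weight i) →
      ∀ (ρ : ℝ), 0 < ρ → ρ < 1 / (n : ℝ) →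
      ∀ (H : Finset (Fin n)), H.card = Nat.sqrt n →
      ∀ (Ω : Type*) [MeasurableSpace Ω] (P : Measure Ω) [IsProbabilityMeasure P]
        (Δ : Ω → Fin k → Matrix (Fin n) (Fin n) ℝ), IsSymmGaussianNoise P ρ Δ →
      ∀ (Sig : Ω → Fin k → Matrix (Fin n) (Fin n) ℝ),
        (∀ w, PerturbationSucceeds G (Δ w) → IsAdmissible G (Δ w) (Sig w)) →
      ∀ (ε : ℝ), 0 < ε →
        cond P {w | PerturbationSucceeds G (Δ w)}
          {w | ¬ (C₃ * ω₀ * (ε * ρ) ^ 2 * (n : ℝ) ^ (3 / 2 : ℝ)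
                    ≤ kthSingularValue (matrixQUS G.weight (Sig w) H) k ∧
                  Submodule.span ℝ (Set.range (matrixQUS G.weight (Sig w) H).col)
                    = Submodule.span ℝ (Set.range fun i =>
                        Matrix.vec (projPerp (columnSpan (Sig w) H) (Sig w i))))}
          ≤ ENNReal.ofReal (2 * (C₁ * ε) ^ (C₂ * (n : ℝ))) := by
  refine ⟨10 ^ 12, 4 * nearConst, 1 / 16, 1 / 10, by norm_num, by rw [nearConst]; norm_num,
    by norm_num, by norm_num, ?_⟩
  intro n k hn G hG ω₀ hω hw ρ hρ hρn H hH Ω _ P _ Δ hΔ Sig hSig ε hε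
  have hk : 0 < k := by
    rcases Nat.eq_zero_or_pos k with rfl | h
    · simpa using G.weight_sum
    · exact h
  have hn' : 10 ^ 12 * k ^ 2 ≤ n := by exact_mod_cast hn
  have hn12 : 10 ^ 12 ≤ n := (Nat.le_mul_of_pos_right _ (pow_pos hk 2)).trans hn'
  have hs := hΔ.measurableSet_succeeds G
  have hhalf := hΔ.half_le_succeeds hρ hρn hk
    (block_sizes hk hn' hH (card_strictPairs_ge H)).2.1
    (by have : (10 ^ 12 : ℝ) ≤ n := by exact_mod_cast hn12
        linarith) hG
  rcases lt_or_ge 1 (4 * nearConst * ε) with hC | hC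
  · -- the bound exceeds `1`
    have h1 : (1 : ℝ) ≤ (4 * nearConst * ε) ^ (1 / 16 * (n : ℝ)) :=
      Real.one_le_rpow hC.le (by positivity)
    have : IsProbabilityMeasure (cond P {w | PerturbationSucceeds G (Δ w)}) := by
      apply cond_isProbabilityMeasure
      intro h0
      rw [measureReal_def, h0] at hhalf
      norm_num at hhalf
    refine prob_le_one.trans ?_
    rw [← ENNReal.ofReal_one]
    exact ENNReal.ofReal_le_ofReal (by linarith)
  obtain ⟨hsz, -, hnN, hkB, hkB', hm5, hnA, hkA, hkA', hW⟩ :=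
    block_sizes hk hn' hH (card_strictPairs_ge H)
  -- disjoint blocks of `⌊n/4⌋` rows and columns outside `H`
  obtain ⟨I, hIH, hI⟩ := Finset.exists_subset_card_eq (s := Hᶜ) (n := n / 4)
    (by rw [Finset.card_compl, Fintype.card_fin]; omega)
  obtain ⟨J, hJ', hJ⟩ := Finset.exists_subset_card_eq (s := Hᶜ \ I) (n := n / 4)
    (by rw [Finset.card_sdiff_of_subset hIH, Finset.card_compl, Fintype.card_fin]; omega)
  have hIH' : Disjoint I H := Finset.disjoint_left.2 fun x hx => Finset.mem_compl.1 (hIH hx)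
  have hJH' : Disjoint J H := Finset.disjoint_left.2 fun x hx =>
    Finset.mem_compl.1 (Finset.mem_sdiff.1 (hJ' hx)).1
  have hIJ : Disjoint I J := Finset.disjoint_right.2 fun x hx => (Finset.mem_sdiff.1 (hJ' hx)).2
  have hA := hΔ.block_near_le hρ hk G.cov hIJ hIH' hJH' (by rwa [hI, hJ]) (by rwa [hI, hJ])
    (by rwa [hI, hJ]) hε
  have hB := hΔ.sampled_near_le hρ hk G.cov hkB hkB' hε
  rw [hI, hJ] at hA
  rw [cond_apply hs]
  have hinv : (P {w | PerturbationSucceeds G (Δ w)})⁻¹ ≤ ENNReal.ofReal 2 := by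
    rw [← ofReal_measureReal, ← ENNReal.ofReal_inv_of_pos (by linarith)]
    apply ENNReal.ofReal_le_ofReal
    rw [inv_le_comm₀ (by linarith) (by norm_num)]
    linarith
  refine (mul_le_mul' hinv ((measure_mono ?_).trans ((measure_union_le _ _).trans
    (add_le_add hA hB)))).trans ?_
  · rintro w ⟨hw1, hw2⟩
    by_contra hnot
    apply hw2
    rw [Set.mem_union, not_or] at hnot
    obtain ⟨hnA, hnB⟩ := hnot
    simp only [Set.mem_ofPred_eq, not_exists, not_and, not_lt] at hnA hnB
    have hadm := hSig w hw1
    have hNpos : 0 < Fintype.card (StrictPairs H) := by omega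
    have hmpos : 0 < n / 4 * (n / 4) := by omega
    have hgood := matrixQUS_good (I := I) (J := J) (H := H) hk hω hw (fun i => (hadm i).2.1)
      (α := ε * ρ * √((n / 4 * (n / 4) : ℕ) : ℝ))
      (β := ε * ρ * √(Fintype.card (StrictPairs H) : ℝ)) (by positivity) (by positivity)
      (fun v hv l => (hnA v hv l).trans (le_of_eq ?_))
      (fun v hv => (hnB v hv).trans (le_of_eq ?_))
    · exact ⟨(target_le_mul_bounds hω hnN hm5).trans hgood.1, hgood.2⟩
    · congr 1
      ext p
      have h1 (i) : Sig w i p.1 p.2 = G.cov i p.1 p.2 + Δ w i p.1 p.2 :=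
        (hadm i).1 _ _ fun h => Finset.disjoint_left.1 hIJ p.1.2 (h ▸ p.2.2)
      have h2 (i) (j : H) : Sig w i p.1 j = G.cov i p.1 j + Δ w i p.1 j :=
        (hadm i).1 _ _ fun h => Finset.disjoint_left.1 hIH' p.1.2 (h ▸ j.2)
      simp only [h1, h2]
    · congr 1
      ext p
      have h1 (i) : Sig w i p.1.1 p.1.2 = G.cov i p.1.1 p.1.2 + Δ w i p.1.1 p.1.2 :=
        (hadm i).1 _ _ p.2.1.ne
      simp only [h1]
  · have hc : (0 : ℝ) ≤ nearConst * ε := by rw [nearConst]; positivity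
    rw [← ENNReal.ofReal_add (by positivity) (by positivity), ← ENNReal.ofReal_mul (by norm_num)]
    exact ENNReal.ofReal_le_ofReal (failure_bound_le hε hC (by omega) hnA hnN)
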